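/- All manifolds, maps and tensor fields are smooth. Let $(M^3,g)$ be a 3-dimensional Riemannian manifold of constant sectional curvature $c$ (a space form), $(N^2,h)$ a Riemannian surface, and $\varphi:(M^3,g)\to(N^2,h)$ a Riemannian submersion. Let $\nabla$, $\nabla^N$ be the Levi-Civita connections, $\nabla^\varphi$ the induced connection on $\varphi^{-1}TN$, and $R^N(X,Y)=\nabla^N_X\nabla^N_Y-\nabla^N_Y\nabla^N_X-\nabla^N_{[X,Y]}$. For a section $W$ of $\varphi^{-1}TN$ and local orthonormal frames $\{u_i\}$ of $M$ put $$\overline\triangle W=\sum_i\big(\nabla^\varphi_{u_i}\nabla^\varphi_{u_i}W-\nabla^\varphi_{\nabla_{u_i}u_i}W\big),\qquad J(W)=\overline\triangle W-\sum_i R^N(W,d\varphi(u_i))d\varphi(u_i),$$ $$\tau(\varphi)=\sum_i\big(\nabla^\varphi_{u_i}d\varphi(u_i)-d\varphi(\nabla_{u_i}u_i)\big),\qquad \tau_3(\varphi)=J(\overline\triangle\tau(\varphi))-\sum_i R^N(\nabla^\varphi_{u_i}\tau(\varphi),\tau(\varphi))d\varphi(u_i).$$ The map $\varphi$ is called triharmonic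 on an open set $U\subseteq M$ if $\tau_3(\varphi)=0$ on $U$, and triharmonic if this holds on $U=M$. Let $\{e_1,e_2,e_3\}$ be an orthonormal frame on an open set $U\subseteq M$ adapted to $\varphi$: $e_3$ is vertical, and $d\varphi(e_1)=\epsilon_1\circ\varphi$, $d\varphi(e_2)=\epsilon_2\circ\varphi$ for an orthonormal frame $\{\epsilon_1,\epsilon_2\}$ on an open set of $N$ containing $\varphi(U)$. Let $f_1,f_2,k_1,k_2,\sigma$ be its integrability data, that is, $[\epsilon_1,\epsilon_2]=F_1\epsilon_1+F_2\epsilon_2$, $f_i=F_i\circ\varphi$, and $$[e_1,e_3]=k_1e_3,\qquad [e_2,e_3]=k_2e_3,\qquad [e_1,e_2]=f_1e_1+f_2e_2-2\sigma e_3 .$$ Suppose that $k_2=0$ on $U$. Let $\triangle^M$ be the Laplace–Beltrami operator $\triangle^M u=\sum_i\big(e_i(e_i(u))-(\nabla_{e_i}e_i)(u)\big)$ of $(M,g)$, let $K^N$ be the Gaussian curvature of $(N,h)$ composed with $\varphi$, and put $$A'=-\triangle^M k_1+k_1f_1^2+k_1f_2^2,$$ $$B'=f_1e_1(k_1)+e_1(k_1f_1)+f_2e_2(k_1)+e_2(k_1f_2)-f_1k_1^2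 .$$ Then $\varphi$ is triharmonic on $U$ (for $U=M$: $\varphi$ is triharmonic) if and only if on $U$ $$\triangle^M A'+f_1e_1(B')+e_1(B'f_1)+f_2e_2(B')+e_2(B'f_2)-f_1k_1B'-A'\{K^N+f_1^2+f_2^2\}-K^N k_1^2f_2=0,$$ $$\triangle^M B'-f_1e_1(A')-e_1(A'f_1)-f_2e_2(A')-e_2(A'f_2)+f_1k_1A'-B'\{K^N+f_1^2+f_2^2\}+K^N k_1^2f_1=0 .$$ -/

import Mathlib

open Bundle Set VectorField
open scoped Manifold ContDiff

noncomputable section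

namespace TriharmonicSubmersion

/-- A smooth Riemannian metric on an `n`-dimensional manifold `M`. -/
abbrev Metric (n : ℕ) (M : Type*) [TopologicalSpace M] [ChartedSpace (EuclideanSpace ℝ (Fin n)) M]
    [IsManifold (𝓡 n) ∞ M] :=
  ContMDiffRiemannianMetric (𝓡 n) ∞ (EuclideanSpace ℝ (Fin n))
    (fun x : M => TangentSpace (𝓡 n) x)

section Calculus

variable {n : ℕ} {M : Type*} [TopologicalSpace M] [ChartedSpace (EuclideanSpace ℝ (Fin n)) M]
  [IsManifold (𝓡 n) ∞ M]

/-- The derivative `v(u)` of the function `u` at `x` in the direction `v ∈ T_x M`. -/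
def vecDeriv (u : M → ℝ) (x : M) (v : TangentSpace (𝓡 n) x) : ℝ :=
  mfderiv (𝓡 n) 𝓘(ℝ, ℝ) u x v

/-- The function `X(u)`: the derivative of `u` in the direction of the vector field `X`. -/
def dirDeriv (X : Π x : M, TangentSpace (𝓡 n) x) (u : M → ℝ) (x : M) : ℝ :=
  vecDeriv u x (X x)

/-- The local vector field around `x` that extends the tangent vector `v` at `x` and has constant
components in the chart centred at `x`. -/
def ext {x : M} (v : TangentSpace (𝓡 n) x) : Π y : M, TangentSpace (𝓡 n) y :=
  FiberBundle.extend (EuclideanSpace ℝ (Fin n)) v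

/-- The metric read in the trivialization of `TM` by the chart centred at `x`: a function near `x`
with values in the bilinear forms on `ℝⁿ` (the matrix of coefficients `g_{ij}`). -/
def metricCoord (g : Metric n M) (x : M) (y : M) :
    EuclideanSpace ℝ (Fin n) →L[ℝ] EuclideanSpace ℝ (Fin n) →L[ℝ] ℝ :=
  let G : EuclideanSpace ℝ (Fin n) →L[ℝ] EuclideanSpace ℝ (Fin n) →L[ℝ] ℝ := g.inner y
  let S : EuclideanSpace ℝ (Fin n) →L[ℝ] EuclideanSpace ℝ (Fin n) :=
    (trivializationAt (EuclideanSpace ℝ (Fin n)) (TangentSpace (𝓡 n)) x).symmL ℝ y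
  G.bilinearComp S S

/-- The first derivatives of the coefficients of the metric at `x`, in the chart centred at `x`:
`metricDeriv g x u v w = D_u (g(v, w))`, with `v`, `w` constant in that chart. (The tangent space
at `x` is identified with `ℝⁿ` by the chart centred at `x`, as everywhere in Mathlib.) -/
def metricDeriv (g : Metric n M) (x : M) :
    EuclideanSpace ℝ (Fin n) →L[ℝ] EuclideanSpace ℝ (Fin n) →L[ℝ]
      EuclideanSpace ℝ (Fin n) →L[ℝ] ℝ :=
  mfderiv (𝓡 n) 𝓘(ℝ, EuclideanSpace ℝ (Fin n) →L[ℝ] EuclideanSpace ℝ (Fin n) →L[ℝ] ℝ)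
    (metricCoord g x) x

/-- The Christoffel symbols of the first kind at `x`, in the chart centred at `x`:
`z ↦ (D_u g(v, z) + D_v g(u, z) - D_z g(u, v)) / 2`. -/
def christoffelLower (g : Metric n M) (x : M) (u v : EuclideanSpace ℝ (Fin n)) :
    EuclideanSpace ℝ (Fin n) →L[ℝ] ℝ :=
  (1 / 2 : ℝ) • (metricDeriv g x u v + metricDeriv g x v u - ((metricDeriv g x).flip u).flip v)

/-- The scalar product on the tangent space at `x`, as a bilinear form on `ℝⁿ`. -/
def metricForm (g : Metric n M) (x : M) : LinearMap.BilinForm ℝ (EuclideanSpace ℝ (Fin n)) :=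
  LinearMap.mk₂ ℝ (fun u v => g.inner x (u : TangentSpace (𝓡 n) x) (v : TangentSpace (𝓡 n) x))
    (fun u u' v => by
      have h := (g.inner x).map_add (u : TangentSpace (𝓡 n) x) u'
      exact (congrArg (fun L => L (v : TangentSpace (𝓡 n) x)) h))
    (fun a u v => by
      have h := (g.inner x).map_smul a (u : TangentSpace (𝓡 n) x)
      exact (congrArg (fun L => L (v : TangentSpace (𝓡 n) x)) h))
    (fun u v v' => (g.inner x (u : TangentSpace (𝓡 n) x)).map_add v v')
    (fun a u v => (g.inner x (u : TangentSpace (𝓡 n) x)).map_smul a v)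

theorem metricForm_nondegenerate (g : Metric n M) (x : M) : (metricForm g x).Nondegenerate := by
  constructor
  · intro v hv
    by_contra h
    exact (g.pos x v h).ne' (hv v)
  · intro v hv
    by_contra h
    exact (g.pos x v h).ne' (hv v)

/-- The Christoffel symbols (of the second kind) at `x`, in the chart centred at `x`: `Γ(u, v)` is
the vector with `g(Γ(u, v), z) = (D_u g(v, z) + D_v g(u, z) - D_z g(u, v)) / 2` for all `z`. -/
def christoffel (g : Metric n M) (x : M) (u v : EuclideanSpace ℝ (Fin n)) :
    EuclideanSpace ℝ (Fin n) :=
  ((metricForm g x).toDual (metricForm_nondegenerate g x)).symm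
    (christoffelLower g x u v : EuclideanSpace ℝ (Fin n) →ₗ[ℝ] ℝ)

/-- The trace `∑ᵢⱼ gⁱʲ B(bᵢ, bⱼ)` with respect to the metric of a bilinear expression `B` on the
tangent space at `x`; it equals `∑ᵢ B(eᵢ, eᵢ)` for every orthonormal basis `eᵢ`. -/
def metricTrace (g : Metric n M) (x : M) {F : Type*} [AddCommGroup F] [Module ℝ F]
    (B : TangentSpace (𝓡 n) x → TangentSpace (𝓡 n) x → F) : F :=
  ∑ i : Fin n, ∑ j : Fin n,
    (Matrix.of fun a b : Fin n => metricForm g x (EuclideanSpace.single a 1)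
      (EuclideanSpace.single b 1))⁻¹ i j •
      B (EuclideanSpace.single i (1 : ℝ) : EuclideanSpace ℝ (Fin n))
        (EuclideanSpace.single j (1 : ℝ) : EuclideanSpace ℝ (Fin n))

end Calculus

section Maps

variable {m n : ℕ}
  {M : Type*} [TopologicalSpace M] [ChartedSpace (EuclideanSpace ℝ (Fin m)) M]
  [IsManifold (𝓡 m) ∞ M]
  {N : Type*} [TopologicalSpace N] [ChartedSpace (EuclideanSpace ℝ (Fin n)) N]
  [IsManifold (𝓡 n) ∞ N]

/-- The derivative at `x`, in the direction `v ∈ T_x M`, of the components of the section `V` along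
`φ` with respect to the chart of `N` centred at `φ x`. -/
def compDeriv (φ : M → N) (V : Π x : M, TangentSpace (𝓡 n) (φ x)) (x : M)
    (v : TangentSpace (𝓡 m) x) : EuclideanSpace ℝ (Fin n) :=
  mfderiv (𝓡 m) 𝓘(ℝ, EuclideanSpace ℝ (Fin n))
    (fun y : M => (trivializationAt (EuclideanSpace ℝ (Fin n)) (TangentSpace (𝓡 n)) (φ x)
      (⟨φ y, V y⟩ : TangentBundle (𝓡 n) N)).2) x v

/-- The connection on `φ⁻¹TN` induced by the Levi-Civita connection of `h`: the derivative
`∇^φ_v V` at `x` of the section `V` along `φ` in the direction `v ∈ T_x M`. In the chart of `N`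
centred at `φ x` it is `D_v V + Γ(dφ v, V)`. -/
def inducedConn (h : Metric n N) (φ : M → N) (V : Π x : M, TangentSpace (𝓡 n) (φ x)) (x : M)
    (v : TangentSpace (𝓡 m) x) : TangentSpace (𝓡 n) (φ x) :=
  compDeriv φ V x v + christoffel h (φ x) (mfderiv (𝓡 m) (𝓡 n) φ x v) (V x)

/-- The Levi-Civita connection `∇_v Y` of `h` at the point `y`. In the chart of `N` centred at `y`
it is `D_v Y + Γ(v, Y)`. -/
def leviCivita (h : Metric n N) (Y : Π y : N, TangentSpace (𝓡 n) y) (y : N)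
    (v : TangentSpace (𝓡 n) y) : TangentSpace (𝓡 n) y :=
  compDeriv (fun z : N => z) Y y v + christoffel h y v (Y y)

/-- `∇_X ∇_Y Z - ∇_Y ∇_X Z - ∇_{[X, Y]} Z` for vector fields `X`, `Y`, `Z`. -/
def curvatureField (h : Metric n N) (X Y Z : Π y : N, TangentSpace (𝓡 n) y) (y : N) :
    TangentSpace (𝓡 n) y :=
  leviCivita h (fun z => leviCivita h Z z (Y z)) y (X y)
    - leviCivita h (fun z => leviCivita h Z z (X z)) y (Y y)
    - leviCivita h Z y (mlieBracket (𝓡 n) X Y y)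

/-- The curvature tensor `R(u, v)w` at `y`: the value of `curvatureField` on local smooth
extensions of `u`, `v`, `w`. -/
def curvature (h : Metric n N) (y : N) (u v w : TangentSpace (𝓡 n) y) : TangentSpace (𝓡 n) y :=
  curvatureField h (ext u) (ext v) (ext w) y

/-- The sectional curvature of the plane spanned by `u` and `v`. -/
def sectionalCurvature (h : Metric n N) (y : N) (u v : TangentSpace (𝓡 n) y) : ℝ :=
  h.inner y (curvature h y u v v) u /
    (h.inner y u u * h.inner y v v - h.inner y u v ^ 2)

/-- All sectional curvatures are equal to `c`. -/
def HasConstantCurvature (h : Metric n N) (c : ℝ) : Prop :=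
  ∀ (y : N) (u v : TangentSpace (𝓡 n) y), LinearIndependent ℝ ![u, v] →
    sectionalCurvature h y u v = c

/-- The Laplace-Beltrami operator on functions, `Δu = trace (Hess u)`, with
`Hess u (X, Y) = X(Y(u)) - (∇_X Y)(u)`. -/
def laplacian (g : Metric m M) (u : M → ℝ) (x : M) : ℝ :=
  metricTrace g x fun v w =>
    vecDeriv (dirDeriv (ext w) u) x v - vecDeriv u x (leviCivita g (ext w) x v)

/-- The rough Laplacian on sections of `φ⁻¹TN`: the trace of
`(X, Y) ↦ ∇^φ_X ∇^φ_Y V - ∇^φ_{∇_X Y} V`. -/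
def roughLaplacian (g : Metric m M) (h : Metric n N) (φ : M → N)
    (V : Π x : M, TangentSpace (𝓡 n) (φ x)) (x : M) : TangentSpace (𝓡 n) (φ x) :=
  metricTrace g x fun v w =>
    inducedConn h φ (fun y => inducedConn h φ V y (ext w y)) x v
      - inducedConn h φ V x (leviCivita g (ext w) x v)

/-- The tension field `τ(φ)`: the trace of `(X, Y) ↦ ∇^φ_X (dφ(Y)) - dφ(∇_X Y)`. -/
def tension (g : Metric m M) (h : Metric n N) (φ : M → N) (x : M) : TangentSpace (𝓡 n) (φ x) :=
  metricTrace g x fun v w =>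
    inducedConn h φ (fun y => mfderiv (𝓡 m) (𝓡 n) φ y (ext w y)) x v
      - mfderiv (𝓡 m) (𝓡 n) φ x (leviCivita g (ext w) x v)

/-- `J(V) = ΔV - ∑ᵢ R(V, dφ(eᵢ)) dφ(eᵢ)`, with the rough Laplacian. -/
def jacobi (g : Metric m M) (h : Metric n N) (φ : M → N)
    (V : Π x : M, TangentSpace (𝓡 n) (φ x)) (x : M) : TangentSpace (𝓡 n) (φ x) :=
  roughLaplacian g h φ V x
    - metricTrace g x fun v w =>
        curvature h (φ x) (V x) (mfderiv (𝓡 m) (𝓡 n) φ x v) (mfderiv (𝓡 m) (𝓡 n) φ x w)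

/-- `τ₃(φ) = J(Δ(τ(φ))) - ∑ᵢ R(∇^φ_{eᵢ} τ(φ), τ(φ)) dφ(eᵢ)`, with the rough Laplacian. -/
def tritension (g : Metric m M) (h : Metric n N) (φ : M → N) (x : M) :
    TangentSpace (𝓡 n) (φ x) :=
  jacobi g h φ (roughLaplacian g h φ (tension g h φ)) x
    - metricTrace g x fun v w =>
        curvature h (φ x) (inducedConn h φ (tension g h φ) x v) (tension g h φ x)
          (mfderiv (𝓡 m) (𝓡 n) φ x w)

/-- `φ` is triharmonic on `U` (with `U = univ`: `φ` is triharmonic). -/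
def IsTriharmonicOn (g : Metric m M) (h : Metric n N) (φ : M → N) (U : Set M) : Prop :=
  ∀ x ∈ U, tritension g h φ x = 0

/-- A smooth submersion whose differential is isometric on the orthogonal complement of its
kernel. -/
structure IsRiemannianSubmersion (g : Metric m M) (h : Metric n N) (φ : M → N) : Prop where
  contMDiff : ContMDiff (𝓡 m) (𝓡 n) ∞ φ
  surjective : ∀ x, Function.Surjective (mfderiv (𝓡 m) (𝓡 n) φ x)
  isometric : ∀ (x : M) (u v : TangentSpace (𝓡 m) x),
    (∀ w, mfderiv (𝓡 m) (𝓡 n) φ x w = 0 → g.inner x u w = 0) →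
    (∀ w, mfderiv (𝓡 m) (𝓡 n) φ x w = 0 → g.inner x v w = 0) →
    h.inner (φ x) (mfderiv (𝓡 m) (𝓡 n) φ x u) (mfderiv (𝓡 m) (𝓡 n) φ x v) = g.inner x u v

/-- `X` is a smooth vector field on `U`. -/
def IsSmoothFieldOn (X : Π x : M, TangentSpace (𝓡 m) x) (U : Set M) : Prop :=
  ContMDiffOn (𝓡 m) (𝓡 m).tangent ∞ (fun x => (⟨x, X x⟩ : TangentBundle (𝓡 m) M)) U

/-- `e` is a smooth orthonormal frame on `U`. -/
structure IsOrthonormalFrameOn (g : Metric m M) (e : Fin m → Π x : M, TangentSpace (𝓡 m) x)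
    (U : Set M) : Prop where
  smooth : ∀ i, IsSmoothFieldOn (e i) U
  orthonormal : ∀ x ∈ U, ∀ i j, g.inner x (e i x) (e j x) = if i = j then 1 else 0

end Maps

section Frames

variable
  {M : Type*} [TopologicalSpace M] [ChartedSpace (EuclideanSpace ℝ (Fin 3)) M]
  [IsManifold (𝓡 3) ∞ M]
  {N : Type*} [TopologicalSpace N] [ChartedSpace (EuclideanSpace ℝ (Fin 2)) N]
  [IsManifold (𝓡 2) ∞ N]

/-- `e₁ = e 0`, `e₂ = e 1`, `e₃ = e 2` is an orthonormal frame on the open set `U` adapted to `φ`: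
`e₃` is vertical, and `e₁`, `e₂` are the horizontal lifts of an orthonormal frame `ε₁ = ε 0`,
`ε₂ = ε 1` on an open set `V` of `N` with `φ(U) ⊆ V`. -/
structure IsAdaptedFrame (g : Metric 3 M) (h : Metric 2 N) (φ : M → N) (U : Set M) (V : Set N)
    (e : Fin 3 → Π x : M, TangentSpace (𝓡 3) x)
    (ε : Fin 2 → Π y : N, TangentSpace (𝓡 2) y) : Prop where
  isOpen_U : IsOpen U
  isOpen_V : IsOpen V
  mapsTo : MapsTo φ U V
  frame_M : IsOrthonormalFrameOn g e U
  frame_N : IsOrthonormalFrameOn h ε V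
  vertical : ∀ x ∈ U, mfderiv (𝓡 3) (𝓡 2) φ x (e 2 x) = 0
  lift_fst : ∀ x ∈ U, mfderiv (𝓡 3) (𝓡 2) φ x (e 0 x) = ε 0 (φ x)
  lift_snd : ∀ x ∈ U, mfderiv (𝓡 3) (𝓡 2) φ x (e 1 x) = ε 1 (φ x)

/-- The functions `f₁ = F₁ ∘ φ`, `f₂ = F₂ ∘ φ`, `k₁`, `k₂`, `σ` are the integrability data of the
adapted frame `e` over `ε`. -/
structure IsIntegrabilityData (φ : M → N) (U : Set M) (V : Set N)
    (e : Fin 3 → Π x : M, TangentSpace (𝓡 3) x)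
    (ε : Fin 2 → Π y : N, TangentSpace (𝓡 2) y)
    (F₁ F₂ : N → ℝ) (f₁ f₂ k₁ k₂ σ : M → ℝ) : Prop where
  smooth_F₁ : ContMDiffOn (𝓡 2) 𝓘(ℝ, ℝ) ∞ F₁ V
  smooth_F₂ : ContMDiffOn (𝓡 2) 𝓘(ℝ, ℝ) ∞ F₂ V
  smooth_k₁ : ContMDiffOn (𝓡 3) 𝓘(ℝ, ℝ) ∞ k₁ U
  smooth_k₂ : ContMDiffOn (𝓡 3) 𝓘(ℝ, ℝ) ∞ k₂ U
  smooth_σ : ContMDiffOn (𝓡 3) 𝓘(ℝ, ℝ) ∞ σ U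
  f₁_eq : ∀ x ∈ U, f₁ x = F₁ (φ x)
  f₂_eq : ∀ x ∈ U, f₂ x = F₂ (φ x)
  bracket_N : ∀ y ∈ V, mlieBracket (𝓡 2) (ε 0) (ε 1) y = F₁ y • ε 0 y + F₂ y • ε 1 y
  bracket_13 : ∀ x ∈ U, mlieBracket (𝓡 3) (e 0) (e 2) x = k₁ x • e 2 x
  bracket_23 : ∀ x ∈ U, mlieBracket (𝓡 3) (e 1) (e 2) x = k₂ x • e 2 x
  bracket_12 : ∀ x ∈ U, mlieBracket (𝓡 3) (e 0) (e 1) x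
    = f₁ x • e 0 x + f₂ x • e 1 x - (2 * σ x) • e 2 x

end Frames

end TriharmonicSubmersion

end

/-! Over `U` the bundle `φ⁻¹TN` is trivialized by `ε₁ ∘ φ`, `ε₂ ∘ φ`, and the induced connection
becomes one scalar form `ω`: `∇^φ_v (P ε₁ + Q ε₂) = (v(P) + ω(v) Q) ε₁ + (v(Q) - ω(v) P) ε₂`.
Torsion-freeness and metric compatibility on `N` give `ω(e₁) = f₁`, `ω(e₂) = f₂`, and `ω(e₃) = 0`
because `dφ(e₃) = 0`. On `M` a trace of second derivatives needs only the fields `∇_{eᵢ} eᵢ`, which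
the brackets determine, and their sum is `(f₂ + k₁) e₁ + (k₂ - f₁) e₂`.

Tracing twice gives the rough Laplacian of any section `P ε₁ + Q ε₂`
(`IsIntegrabilityData.roughLaplacian_eq`), while `τ(φ) = -k₁ ε₁ - k₂ ε₂`
(`IsIntegrabilityData.tension_eq`). If `k₂ = 0`, the rough Laplacian of `τ(φ)` is `A' ε₁ + B' ε₂`,
and the same formula applied to that section yields the leading part of `τ₃(φ)`. The curvature of a
surface is `R(X, Y)Z = K dA(X, Y) (z₂ ε₁ - z₁ ε₂)`, `dA` being the area form
(`IsOrthonormalFrameOn.curvature_eq`). Hence `∑ R(W, dφ eᵢ) dφ eᵢ = K W`, and the last term of `τ₃`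
contributes `K k₁² (f₂ ε₁ - f₁ ε₂)` before its minus sign. The two equations are the components of
`τ₃(φ)` in `ε₁`, `ε₂`.

All operators are defined pointwise in the chart centred at the point, with traces through the
inverse Gram matrix and curvature through local extensions. So the Leibniz rule, compatibility, zero
torsion, the commutator formula and the passage to orthonormal frames have to be established
beforehand. -/

namespace TriharmonicSubmersion

open Filter Topology

set_option linter.unusedSectionVars false

/-! ### Directional derivatives of functions on a manifold. -/

section Calculus

variable {n : ℕ} {M : Type*} [TopologicalSpace M] [ChartedSpace (EuclideanSpace ℝ (Fin n)) M]

/-- The product rule for a continuous bilinear map applied to two vector-valued functions on a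
manifold. -/
theorem hasMFDerivAt_bilinear {F G H : Type*} [NormedAddCommGroup F] [NormedSpace ℝ F]
    [NormedAddCommGroup G] [NormedSpace ℝ G] [NormedAddCommGroup H] [NormedSpace ℝ H]
    (β : F →L[ℝ] G →L[ℝ] H) {a : M → F} {b : M → G} {x : M}
    {a' : EuclideanSpace ℝ (Fin n) →L[ℝ] F} {b' : EuclideanSpace ℝ (Fin n) →L[ℝ] G}
    (ha : HasMFDerivAt (𝓡 n) 𝓘(ℝ, F) a x a') (hb : HasMFDerivAt (𝓡 n) 𝓘(ℝ, G) b x b') :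
    HasMFDerivAt (𝓡 n) 𝓘(ℝ, H) (fun y => β (a y) (b y)) x
      ((β.precompR _ (a x) b' + β.precompL _ a' (b x) : EuclideanSpace ℝ (Fin n) →L[ℝ] H)) := by
  refine ⟨(β.continuous.continuousAt.comp ha.1).clm_apply hb.1, ?_⟩
  have h := β.hasFDerivWithinAt_of_bilinear ha.2 hb.2
  simp only [writtenInExtChartAt, Function.comp_def, extChartAt_model_space_eq_id,
    PartialEquiv.refl_coe, id_eq, extChartAt_to_inv] at h ⊢
  exact h

theorem mfderiv_bilinear {F G H : Type*} [NormedAddCommGroup F] [NormedSpace ℝ F]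
    [NormedAddCommGroup G] [NormedSpace ℝ G] [NormedAddCommGroup H] [NormedSpace ℝ H]
    (β : F →L[ℝ] G →L[ℝ] H) {a : M → F} {b : M → G} {x : M}
    (ha : MDifferentiableAt (𝓡 n) 𝓘(ℝ, F) a x) (hb : MDifferentiableAt (𝓡 n) 𝓘(ℝ, G) b x)
    (v : TangentSpace (𝓡 n) x) :
    (mfderiv (𝓡 n) 𝓘(ℝ, H) (fun y => β (a y) (b y)) x v : H) =
      β (a x) (mfderiv (𝓡 n) 𝓘(ℝ, G) b x v : G) + β (mfderiv (𝓡 n) 𝓘(ℝ, F) a x v : F) (b x) := by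
  rw [(hasMFDerivAt_bilinear β ha.hasMFDerivAt hb.hasMFDerivAt).mfderiv]
  rfl

theorem vecDeriv_add_right (u : M → ℝ) (x : M) (v w : TangentSpace (𝓡 n) x) :
    vecDeriv u x (v + w) = vecDeriv u x v + vecDeriv u x w :=
  map_add (mfderiv (𝓡 n) 𝓘(ℝ, ℝ) u x) v w

theorem vecDeriv_smul_right (u : M → ℝ) (x : M) (a : ℝ) (v : TangentSpace (𝓡 n) x) :
    vecDeriv u x (a • v) = a * vecDeriv u x v :=
  map_smul (mfderiv (𝓡 n) 𝓘(ℝ, ℝ) u x) a v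

theorem vecDeriv_congr {u w : M → ℝ} {x : M} (h : u =ᶠ[𝓝 x] w) (v : TangentSpace (𝓡 n) x) :
    vecDeriv u x v = vecDeriv w x v := by
  unfold vecDeriv
  have := h.mfderiv_eq (I := 𝓡 n) (I' := 𝓘(ℝ, ℝ))
  exact congrArg (fun L : EuclideanSpace ℝ (Fin n) →L[ℝ] ℝ => L v) this

theorem vecDeriv_mul {u w : M → ℝ} {x : M} (hu : MDifferentiableAt (𝓡 n) 𝓘(ℝ, ℝ) u x)
    (hw : MDifferentiableAt (𝓡 n) 𝓘(ℝ, ℝ) w x) (v : TangentSpace (𝓡 n) x) :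
    vecDeriv (fun y => u y * w y) x v = vecDeriv u x v * w x + u x * vecDeriv w x v := by
  have := mfderiv_bilinear (ContinuousLinearMap.mul ℝ ℝ) hu hw v
  rw [add_comm]
  exact this

theorem vecDeriv_add {u w : M → ℝ} {x : M} (hu : MDifferentiableAt (𝓡 n) 𝓘(ℝ, ℝ) u x)
    (hw : MDifferentiableAt (𝓡 n) 𝓘(ℝ, ℝ) w x) (v : TangentSpace (𝓡 n) x) :
    vecDeriv (fun y => u y + w y) x v = vecDeriv u x v + vecDeriv w x v := by
  have := mfderiv_add hu hw
  exact congrArg (fun L : EuclideanSpace ℝ (Fin n) →L[ℝ] ℝ => L v) this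

theorem vecDeriv_sub {u w : M → ℝ} {x : M} (hu : MDifferentiableAt (𝓡 n) 𝓘(ℝ, ℝ) u x)
    (hw : MDifferentiableAt (𝓡 n) 𝓘(ℝ, ℝ) w x) (v : TangentSpace (𝓡 n) x) :
    vecDeriv (fun y => u y - w y) x v = vecDeriv u x v - vecDeriv w x v := by
  have := mfderiv_sub hu hw
  exact congrArg (fun L : EuclideanSpace ℝ (Fin n) →L[ℝ] ℝ => L v) this

theorem vecDeriv_neg (u : M → ℝ) (x : M) (v : TangentSpace (𝓡 n) x) :
    vecDeriv (fun y => -u y) x v = -vecDeriv u x v := by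
  have := mfderiv_neg (I := 𝓡 n) (f := u) (x := x)
  exact congrArg (fun L : EuclideanSpace ℝ (Fin n) →L[ℝ] ℝ => L v) this

theorem vecDeriv_const (a : ℝ) (x : M) (v : TangentSpace (𝓡 n) x) :
    vecDeriv (fun _ => a) x v = 0 := by
  have := mfderiv_const (I := 𝓡 n) (I' := 𝓘(ℝ, ℝ)) (c := a) (x := x)
  exact congrArg (fun L : EuclideanSpace ℝ (Fin n) →L[ℝ] ℝ => L v) this

theorem vecDeriv_sum {ι : Type} (s : Finset ι) {u : ι → M → ℝ} {x : M}
    (hu : ∀ i ∈ s, MDifferentiableAt (𝓡 n) 𝓘(ℝ, ℝ) (u i) x) (v : TangentSpace (𝓡 n) x) :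
    vecDeriv (fun y => ∑ i ∈ s, u i y) x v = ∑ i ∈ s, vecDeriv (u i) x v := by
  classical
  induction s using Finset.induction_on with
  | empty => simpa using vecDeriv_const 0 x v
  | insert j s hj ih =>
    simp only [Finset.sum_insert hj]
    have hs : MDifferentiableAt (𝓡 n) 𝓘(ℝ, ℝ) (fun y => ∑ i ∈ s, u i y) x := by
      have := MDifferentiableAt.sum (t := s) (f := u) (z := x)
        fun i hi => hu i (Finset.mem_insert_of_mem hi)
      convert! this using 1
      ext y
      simp
    rw [vecDeriv_add (hu j (Finset.mem_insert_self j s)) hs,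
      ih fun i hi => hu i (Finset.mem_insert_of_mem hi)]

variable [IsManifold (𝓡 n) ∞ M]

/-- `X(u)` is the fibre component of the tangent map of `u` composed with the section `X`, both
smooth. -/
theorem contMDiffOn_dirDeriv {X : Π x : M, TangentSpace (𝓡 n) x} {u : M → ℝ} {U : Set M}
    (hU : IsOpen U) (hX : IsSmoothFieldOn X U) (hu : ContMDiffOn (𝓡 n) 𝓘(ℝ, ℝ) ∞ u U) :
    ContMDiffOn (𝓡 n) 𝓘(ℝ, ℝ) ∞ (dirDeriv X u) U := by
  have : IsManifold (𝓡 n) 1 M := IsManifold.of_le (n := ∞) (by simp)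
  have h := hu.contMDiffOn_tangentMapWithin (m := ∞) (by simp) hU.uniqueMDiffOn
  have h2 := h.comp hX (fun x hx => hx)
  have h3 := (contMDiff_snd_tangentBundle_modelSpace ℝ 𝓘(ℝ, ℝ) (n := ∞)).comp_contMDiffOn h2
  refine h3.congr fun x hx => ?_
  have e := mfderivWithin_of_isOpen (I := 𝓡 n) (I' := 𝓘(ℝ, ℝ)) (f := u) hU hx
  exact congrArg (fun L : EuclideanSpace ℝ (Fin n) →L[ℝ] ℝ => L (X x)) e.symm

end Calculus

/-! ### Algebra and Leibniz rule of the induced connection. -/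

section Connection

variable {m n : ℕ}
  {M : Type*} [TopologicalSpace M] [ChartedSpace (EuclideanSpace ℝ (Fin m)) M]
  [IsManifold (𝓡 m) ∞ M]
  {N : Type*} [TopologicalSpace N] [ChartedSpace (EuclideanSpace ℝ (Fin n)) N]
  [IsManifold (𝓡 n) ∞ N]

/-- The components at `y` of a section along `φ`, in the chart of `N` centred at `φ x`. -/
noncomputable def sectionCoord (φ : M → N) (V : Π x : M, TangentSpace (𝓡 n) (φ x)) (x y : M) :
    EuclideanSpace ℝ (Fin n) :=
  (trivializationAt (EuclideanSpace ℝ (Fin n)) (TangentSpace (𝓡 n)) (φ x)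
    (⟨φ y, V y⟩ : TangentBundle (𝓡 n) N)).2

/-- At its centre, the change from a chart to itself is the identity. This is what makes adding
Christoffel terms to derivatives of components consistent. -/
theorem trivializationAt_self_snd (y : N) (v : TangentSpace (𝓡 n) y) :
    (trivializationAt (EuclideanSpace ℝ (Fin n)) (TangentSpace (𝓡 n)) y
      (⟨y, v⟩ : TangentBundle (𝓡 n) N)).2 = v := by
  rw [TangentBundle.trivializationAt_apply]
  have := (tangentBundleCore (𝓡 n) N).coordChange_self (achart _ y) y (mem_chart_source _ y) v
  simpa using this

theorem sectionCoord_self (φ : M → N) (V : Π x : M, TangentSpace (𝓡 n) (φ x)) (x : M) :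
    sectionCoord φ V x x = V x :=
  trivializationAt_self_snd (φ x) (V x)

/-- Locality of the connection: frame expansions, available only on `U`, may be substituted under
the derivative. -/
theorem inducedConn_congr (h : Metric n N) {φ : M → N} {V W : Π x : M, TangentSpace (𝓡 n) (φ x)}
    {x : M} (hVW : ∀ᶠ y in 𝓝 x, V y = W y) (v : TangentSpace (𝓡 m) x) :
    inducedConn h φ V x v = inducedConn h φ W x v := by
  have h1 : sectionCoord φ V x =ᶠ[𝓝 x] sectionCoord φ W x := by
    filter_upwards [hVW] with y hy
    simp only [sectionCoord, hy]
  have h2 := h1.mfderiv_eq (I := 𝓡 m) (I' := 𝓘(ℝ, EuclideanSpace ℝ (Fin n)))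
  have h3 : compDeriv φ V x v = compDeriv φ W x v :=
    congrArg (fun L : EuclideanSpace ℝ (Fin m) →L[ℝ] EuclideanSpace ℝ (Fin n) => L v) h2
  unfold inducedConn
  rw [h3, hVW.self_of_nhds]

theorem leviCivita_eq_inducedConn (h : Metric n N) (Y : Π y : N, TangentSpace (𝓡 n) y) (y : N)
    (v : TangentSpace (𝓡 n) y) : leviCivita h Y y v = inducedConn h (fun z : N => z) Y y v := by
  unfold leviCivita inducedConn
  have : mfderiv (𝓡 n) (𝓡 n) (fun z : N => z) y v = v := by
    have := mfderiv_id (I := 𝓡 n) (x := y)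
    exact congrArg (fun L : EuclideanSpace ℝ (Fin n) →L[ℝ] EuclideanSpace ℝ (Fin n) => L v) this
  rw [this]

/-- The expression defining the Christoffel symbols of the first kind, for an arbitrary trilinear
form. -/
theorem christoffelLower_eq (h : Metric n N) (y : N) (u v z : EuclideanSpace ℝ (Fin n)) :
    christoffelLower h y u v z = 1 / 2 * (metricDeriv h y u v z + metricDeriv h y v u z
      - metricDeriv h y z u v) := rfl

-- Linearity of the Christoffel expression uses only trilinearity of `D`, not the symmetry of the
-- metric, hence an arbitrary `D`.
set_option synthInstance.maxHeartbeats 200000 in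
theorem trilinear_symm_add {F : Type*} [NormedAddCommGroup F] [NormedSpace ℝ F]
    (D : F →L[ℝ] F →L[ℝ] F →L[ℝ] ℝ) (u v w z : F) :
    1 / 2 * (D u (v + w) z + D (v + w) u z - D z u (v + w)) =
      1 / 2 * (D u v z + D v u z - D z u v) + 1 / 2 * (D u w z + D w u z - D z u w) := by
  simp only [map_add, add_apply]
  ring

set_option synthInstance.maxHeartbeats 200000 in
theorem trilinear_symm_smul {F : Type*} [NormedAddCommGroup F] [NormedSpace ℝ F]
    (D : F →L[ℝ] F →L[ℝ] F →L[ℝ] ℝ) (a : ℝ) (u v z : F) :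
    1 / 2 * (D u (a • v) z + D (a • v) u z - D z u (a • v)) =
      a * (1 / 2 * (D u v z + D v u z - D z u v)) := by
  simp only [map_smul, smul_apply, smul_eq_mul]
  ring

theorem christoffel_add_right (h : Metric n N) (y : N) (u v w : EuclideanSpace ℝ (Fin n)) :
    christoffel h y u (v + w) = christoffel h y u v + christoffel h y u w := by
  unfold christoffel
  rw [← map_add]
  congr 1
  exact LinearMap.ext fun z => trilinear_symm_add (metricDeriv h y) u v w z

theorem christoffel_smul_right (h : Metric n N) (y : N) (a : ℝ) (u v : EuclideanSpace ℝ (Fin n)) :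
    christoffel h y u (a • v) = a • christoffel h y u v := by
  unfold christoffel
  rw [← map_smul]
  congr 1
  exact LinearMap.ext fun z => trilinear_symm_smul (metricDeriv h y) a u v z

set_option synthInstance.maxHeartbeats 200000 in
theorem trilinear_symm_add' {F : Type*} [NormedAddCommGroup F] [NormedSpace ℝ F]
    (D : F →L[ℝ] F →L[ℝ] F →L[ℝ] ℝ) (u v w z : F) :
    1 / 2 * (D (u + v) w z + D w (u + v) z - D z (u + v) w) =
      1 / 2 * (D u w z + D w u z - D z u w) + 1 / 2 * (D v w z + D w v z - D z v w) := by
  simp only [map_add, add_apply]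
  ring

set_option synthInstance.maxHeartbeats 200000 in
theorem trilinear_symm_smul' {F : Type*} [NormedAddCommGroup F] [NormedSpace ℝ F]
    (D : F →L[ℝ] F →L[ℝ] F →L[ℝ] ℝ) (a : ℝ) (u v z : F) :
    1 / 2 * (D (a • u) v z + D v (a • u) z - D z (a • u) v) =
      a * (1 / 2 * (D u v z + D v u z - D z u v)) := by
  simp only [map_smul, smul_apply, smul_eq_mul]
  ring

theorem christoffel_add_left (h : Metric n N) (y : N) (u v w : EuclideanSpace ℝ (Fin n)) :
    christoffel h y (u + v) w = christoffel h y u w + christoffel h y v w := by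
  unfold christoffel
  rw [← map_add]
  congr 1
  exact LinearMap.ext fun z => trilinear_symm_add' (metricDeriv h y) u v w z

theorem christoffel_smul_left (h : Metric n N) (y : N) (a : ℝ) (u v : EuclideanSpace ℝ (Fin n)) :
    christoffel h y (a • u) v = a • christoffel h y u v := by
  unfold christoffel
  rw [← map_smul]
  congr 1
  exact LinearMap.ext fun z => trilinear_symm_smul' (metricDeriv h y) a u v z

theorem christoffel_sum_smul_right (h : Metric n N) (y : N) {ι : Type} (s : Finset ι)
    (a : ι → ℝ) (u : EuclideanSpace ℝ (Fin n)) (v : ι → EuclideanSpace ℝ (Fin n)) :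
    christoffel h y u (∑ i ∈ s, a i • v i) = ∑ i ∈ s, a i • christoffel h y u (v i) := by
  classical
  induction s using Finset.induction_on with
  | empty => simpa using christoffel_smul_right h y 0 u 0
  | insert j s hj ih =>
    rw [Finset.sum_insert hj, Finset.sum_insert hj, christoffel_add_right, ih,
      christoffel_smul_right]

theorem inducedConn_add_right (h : Metric n N) (φ : M → N)
    (V : Π x : M, TangentSpace (𝓡 n) (φ x)) (x : M) (v w : TangentSpace (𝓡 m) x) :
    inducedConn h φ V x (v + w) = inducedConn h φ V x v + inducedConn h φ V x w := by
  have h1 : compDeriv φ V x (v + w) = compDeriv φ V x v + compDeriv φ V x w :=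
    map_add (mfderiv (𝓡 m) 𝓘(ℝ, EuclideanSpace ℝ (Fin n)) (sectionCoord φ V x) x) v w
  have h2 : mfderiv (𝓡 m) (𝓡 n) φ x (v + w) = mfderiv (𝓡 m) (𝓡 n) φ x v +
    mfderiv (𝓡 m) (𝓡 n) φ x w := map_add _ v w
  have h3 := christoffel_add_left h (φ x) (mfderiv (𝓡 m) (𝓡 n) φ x v)
    (mfderiv (𝓡 m) (𝓡 n) φ x w) (V x)
  unfold inducedConn
  rw [h1, h2]
  exact (congrArg _ h3).trans (add_add_add_comm (G := EuclideanSpace ℝ (Fin n)) _ _ _ _)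

theorem inducedConn_smul_right (h : Metric n N) (φ : M → N)
    (V : Π x : M, TangentSpace (𝓡 n) (φ x)) (x : M) (a : ℝ) (v : TangentSpace (𝓡 m) x) :
    inducedConn h φ V x (a • v) = a • inducedConn h φ V x v := by
  have h1 : compDeriv φ V x (a • v) = a • compDeriv φ V x v :=
    map_smul (mfderiv (𝓡 m) 𝓘(ℝ, EuclideanSpace ℝ (Fin n)) (sectionCoord φ V x) x) a v
  have h2 : mfderiv (𝓡 m) (𝓡 n) φ x (a • v) = a • mfderiv (𝓡 m) (𝓡 n) φ x v := map_smul _ a v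
  have h3 := christoffel_smul_left h (φ x) a (mfderiv (𝓡 m) (𝓡 n) φ x v) (V x)
  unfold inducedConn
  rw [h1, h2]
  exact (congrArg _ h3).trans (smul_add (M := ℝ) (A := EuclideanSpace ℝ (Fin n)) a _ _).symm

/-- The trivialization is linear on fibres only over its base set, so `φ y` must lie in the chart
domain. -/
theorem sectionCoord_sum (φ : M → N) {ι : Type} (s : Finset ι) (a : ι → M → ℝ)
    (W : ι → Π x : M, TangentSpace (𝓡 n) (φ x)) (x : M) {y : M}
    (hy : φ y ∈ (chartAt (EuclideanSpace ℝ (Fin n)) (φ x)).source) :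
    sectionCoord φ (fun y => ∑ i ∈ s, a i y • W i y) x y =
      ∑ i ∈ s, a i y • sectionCoord φ (W i) x y := by
  have key : ∀ w : TangentSpace (𝓡 n) (φ y),
      (trivializationAt (EuclideanSpace ℝ (Fin n)) (TangentSpace (𝓡 n)) (φ x)
        (⟨φ y, w⟩ : TangentBundle (𝓡 n) N)).2 =
      (trivializationAt (EuclideanSpace ℝ (Fin n)) (TangentSpace (𝓡 n)) (φ x)).linearMapAt ℝ
        (φ y) w := fun w => by
    rw [Trivialization.linearMapAt_apply, if_pos]
    simpa using hy
  simp only [sectionCoord, key]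
  rw [map_sum]
  simp only [map_smul]

/-- The components of the section `V` along `φ` in the chart at `φ x` are differentiable
at `x`. -/
def SectionDiffAt (m : ℕ) {M : Type*} [TopologicalSpace M]
    [ChartedSpace (EuclideanSpace ℝ (Fin m)) M] (φ : M → N) (V : Π x : M, TangentSpace (𝓡 n) (φ x)) (x : M) : Prop :=
  MDifferentiableAt (𝓡 m) 𝓘(ℝ, EuclideanSpace ℝ (Fin n)) (sectionCoord φ V x) x

theorem compDeriv_sum (φ : M → N) {ι : Type} (s : Finset ι) {a : ι → M → ℝ}
    {W : ι → Π x : M, TangentSpace (𝓡 n) (φ x)} {x : M} (hφ : ContinuousAt φ x)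
    (ha : ∀ i ∈ s, MDifferentiableAt (𝓡 m) 𝓘(ℝ, ℝ) (a i) x)
    (hW : ∀ i ∈ s, SectionDiffAt m φ (W i) x) (v : TangentSpace (𝓡 m) x) :
    compDeriv φ (fun y => ∑ i ∈ s, a i y • W i y) x v =
      ∑ i ∈ s, (vecDeriv (a i) x v • sectionCoord φ (W i) x x
        + a i x • compDeriv φ (W i) x v) := by
  have h1 : sectionCoord φ (fun y => ∑ i ∈ s, a i y • W i y) x =ᶠ[𝓝 x]
      ∑ i ∈ s, fun y => a i y • sectionCoord φ (W i) x y := by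
    filter_upwards [hφ.preimage_mem_nhds
      ((chartAt (EuclideanSpace ℝ (Fin n)) (φ x)).open_source.mem_nhds (mem_chart_source _ _))]
      with y hy
    rw [sectionCoord_sum φ s a W x hy]
    simp
  have h2 := HasMFDerivAt.sum (t := s) (f := fun i y => a i y • sectionCoord φ (W i) x y)
    fun i hi => hasMFDerivAt_bilinear (ContinuousLinearMap.lsmul ℝ ℝ) (ha i hi).hasMFDerivAt
      (hW i hi).hasMFDerivAt
  have h3 : compDeriv φ (fun y => ∑ i ∈ s, a i y • W i y) x v = _ :=
    congrArg (fun L : EuclideanSpace ℝ (Fin m) →L[ℝ] EuclideanSpace ℝ (Fin n) => L v)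
      (h1.mfderiv_eq.trans h2.mfderiv)
  refine h3.trans ((sum_apply (F := EuclideanSpace ℝ (Fin m) →L[ℝ] EuclideanSpace ℝ (Fin n))
    s _ v).trans ?_)
  refine Finset.sum_congr rfl fun i _ => ?_
  rw [add_comm]
  rfl

/-- The Leibniz rule for the induced connection. -/
theorem inducedConn_sum (h : Metric n N) (φ : M → N) {ι : Type} (s : Finset ι) {a : ι → M → ℝ}
    {W : ι → Π x : M, TangentSpace (𝓡 n) (φ x)} {x : M} (hφ : ContinuousAt φ x)
    (ha : ∀ i ∈ s, MDifferentiableAt (𝓡 m) 𝓘(ℝ, ℝ) (a i) x)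
    (hW : ∀ i ∈ s, SectionDiffAt m φ (W i) x) (v : TangentSpace (𝓡 m) x) :
    inducedConn h φ (fun y => ∑ i ∈ s, a i y • W i y) x v =
      ∑ i ∈ s, (vecDeriv (a i) x v • W i x + a i x • inducedConn h φ (W i) x v) := by
  have h1 := compDeriv_sum φ s hφ ha hW v
  have h2 := christoffel_sum_smul_right h (φ x) s (fun i => a i x) (mfderiv (𝓡 m) (𝓡 n) φ x v)
    (fun i => W i x)
  simp only [sectionCoord_self] at h1
  unfold inducedConn
  rw [h1]
  refine (congrArg _ h2).trans ?_
  refine (Finset.sum_add_distrib (M := EuclideanSpace ℝ (Fin n))).symm.trans ?_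
  refine Finset.sum_congr rfl fun i _ => ?_
  refine (add_assoc (G := EuclideanSpace ℝ (Fin n)) _ _ _).trans ?_
  exact congrArg _ (smul_add (M := ℝ) (A := EuclideanSpace ℝ (Fin n)) _ _ _).symm

theorem sectionDiffAt_id_iff {Y : Π y : N, TangentSpace (𝓡 n) y} {y : N} :
    SectionDiffAt n (fun z : N => z) Y y ↔
      MDifferentiableAt (𝓡 n) (𝓡 n).tangent (fun y => (⟨y, Y y⟩ : TangentBundle (𝓡 n) N)) y :=
  (mdifferentiableAt_section (IB := 𝓡 n) Y).symm

theorem SectionDiffAt.comp {φ : M → N} {Y : Π y : N, TangentSpace (𝓡 n) y} {x : M}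
    (hY : SectionDiffAt n (fun z : N => z) Y (φ x)) (hφ : MDifferentiableAt (𝓡 m) (𝓡 n) φ x) :
    SectionDiffAt m φ (fun y => Y (φ y)) x :=
  MDifferentiableAt.comp (I' := 𝓡 n) (g := sectionCoord (fun z : N => z) Y (φ x)) x hY hφ

/-- The connection along `φ` of the restriction of a vector field on `N`. -/
theorem inducedConn_comp (h : Metric n N) {φ : M → N} {Y : Π y : N, TangentSpace (𝓡 n) y} {x : M}
    (hY : SectionDiffAt n (fun z : N => z) Y (φ x)) (hφ : MDifferentiableAt (𝓡 m) (𝓡 n) φ x)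
    (v : TangentSpace (𝓡 m) x) :
    inducedConn h φ (fun y => Y (φ y)) x v =
      leviCivita h Y (φ x) (mfderiv (𝓡 m) (𝓡 n) φ x v) := by
  have h1 := mfderiv_comp (I := 𝓡 m) (I' := 𝓡 n) (I'' := 𝓘(ℝ, EuclideanSpace ℝ (Fin n))) x hY hφ
  have h2 : compDeriv φ (fun y => Y (φ y)) x v =
      compDeriv (fun z : N => z) Y (φ x) (mfderiv (𝓡 m) (𝓡 n) φ x v) :=
    congrArg (fun L : EuclideanSpace ℝ (Fin m) →L[ℝ] EuclideanSpace ℝ (Fin n) => L v) h1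
  unfold inducedConn leviCivita
  rw [h2]

theorem SectionDiffAt.sum {φ : M → N} {ι : Type} {s : Finset ι} {a : ι → M → ℝ}
    {W : ι → Π x : M, TangentSpace (𝓡 n) (φ x)} {x : M} (hφ : ContinuousAt φ x)
    (ha : ∀ i ∈ s, MDifferentiableAt (𝓡 m) 𝓘(ℝ, ℝ) (a i) x)
    (hW : ∀ i ∈ s, SectionDiffAt m φ (W i) x) :
    SectionDiffAt m φ (fun y => ∑ i ∈ s, a i y • W i y) x := by
  have h1 : sectionCoord φ (fun y => ∑ i ∈ s, a i y • W i y) x =ᶠ[𝓝 x]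
      ∑ i ∈ s, fun y => a i y • sectionCoord φ (W i) x y := by
    filter_upwards [hφ.preimage_mem_nhds
      ((chartAt (EuclideanSpace ℝ (Fin n)) (φ x)).open_source.mem_nhds (mem_chart_source _ _))]
      with y hy
    rw [sectionCoord_sum φ s a W x hy]
    simp
  have h2 := HasMFDerivAt.sum (t := s) (f := fun i y => a i y • sectionCoord φ (W i) x y)
    fun i hi => hasMFDerivAt_bilinear (ContinuousLinearMap.lsmul ℝ ℝ) (ha i hi).hasMFDerivAt
      (hW i hi).hasMFDerivAt
  exact h2.mdifferentiableAt.congr_of_eventuallyEq h1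

theorem SectionDiffAt.congr {φ : M → N} {V W : Π x : M, TangentSpace (𝓡 n) (φ x)} {x : M}
    (hW : SectionDiffAt m φ W x) (hVW : ∀ᶠ y in 𝓝 x, V y = W y) : SectionDiffAt m φ V x := by
  refine MDifferentiableAt.congr_of_eventuallyEq hW ?_
  filter_upwards [hVW] with y hy
  simp only [sectionCoord, hy]

end Connection

/-! ### Torsion-freeness and metric compatibility. -/

section LeviCivita

variable {n : ℕ}
  {N : Type*} [TopologicalSpace N] [ChartedSpace (EuclideanSpace ℝ (Fin n)) N]
  [IsManifold (𝓡 n) ∞ N]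

/-- The components of a vector field in the chart centred at `x`, as a function on the chart. -/
noncomputable def chartField (Y : Π y : N, TangentSpace (𝓡 n) y) (x : N) :
    EuclideanSpace ℝ (Fin n) → EuclideanSpace ℝ (Fin n) :=
  mpullbackWithin 𝓘(ℝ, EuclideanSpace ℝ (Fin n)) (𝓡 n) (extChartAt (𝓡 n) x).symm Y (range (𝓡 n))

/-- The Lie bracket is defined by pulling fields back to the chart, the connection by reading them
in the trivialization. The two agree because the trivialization acts on fibres as the derivative of
the chart. -/
theorem chartField_eq (Y : Π y : N, TangentSpace (𝓡 n) y) (x : N)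
    {z : EuclideanSpace ℝ (Fin n)} (hz : z ∈ (extChartAt (𝓡 n) x).target) :
    chartField Y x z = sectionCoord (fun y : N => y) Y x ((extChartAt (𝓡 n) x).symm z) := by
  have : IsManifold (𝓡 n) 1 N := IsManifold.of_le (n := ∞) (by simp)
  have hsrc : (extChartAt (𝓡 n) x).symm z ∈ (chartAt (EuclideanSpace ℝ (Fin n)) x).source := by
    simpa using (extChartAt (𝓡 n) x).map_target hz
  have h1 := ContinuousLinearMap.inverse_eq
    (mfderivWithin_extChartAt_symm_comp_mfderiv_extChartAt (I := 𝓡 n) hz)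
    (mfderiv_extChartAt_comp_mfderivWithin_extChartAt_symm (I := 𝓡 n) hz)
  rw [chartField, mpullbackWithin_apply, h1,
    ← TangentBundle.continuousLinearMapAt_trivializationAt hsrc]
  exact Trivialization.continuousLinearMapAt_apply_of_mem ℝ _ (by simpa using hsrc) _

theorem chartField_self (Y : Π y : N, TangentSpace (𝓡 n) y) (x : N) :
    chartField Y x (extChartAt (𝓡 n) x x) = Y x := by
  rw [chartField_eq Y x (mem_extChartAt_target x), extChartAt_to_inv]
  exact sectionCoord_self _ _ _

theorem compDeriv_id_eq {Y : Π y : N, TangentSpace (𝓡 n) y} {x : N}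
    (hY : SectionDiffAt n (fun z : N => z) Y x) (v : EuclideanSpace ℝ (Fin n)) :
    compDeriv (fun z : N => z) Y x (v : TangentSpace (𝓡 n) x) =
      fderiv ℝ (chartField Y x) (extChartAt (𝓡 n) x x) v := by
  have h1 : mfderiv (𝓡 n) 𝓘(ℝ, EuclideanSpace ℝ (Fin n)) (sectionCoord (fun z : N => z) Y x) x =
      fderivWithin ℝ (writtenInExtChartAt (𝓡 n) 𝓘(ℝ, EuclideanSpace ℝ (Fin n)) x
        (sectionCoord (fun z : N => z) Y x)) (range (𝓡 n)) (extChartAt (𝓡 n) x x) := if_pos hY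
  have h2 : writtenInExtChartAt (𝓡 n) 𝓘(ℝ, EuclideanSpace ℝ (Fin n)) x
        (sectionCoord (fun z : N => z) Y x) =ᶠ[𝓝 (extChartAt (𝓡 n) x x)] chartField Y x := by
    filter_upwards [extChartAt_target_mem_nhds (I := 𝓡 n) x] with z hz
    rw [chartField_eq Y x hz]
    rfl
  have h3 : range (𝓡 n) = univ := ModelWithCorners.range_eq_univ _
  have h4 : fderivWithin ℝ (writtenInExtChartAt (𝓡 n) 𝓘(ℝ, EuclideanSpace ℝ (Fin n)) x
        (sectionCoord (fun z : N => z) Y x)) (range (𝓡 n)) (extChartAt (𝓡 n) x x) =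
      fderiv ℝ (chartField Y x) (extChartAt (𝓡 n) x x) := by
    rw [h3, fderivWithin_univ, h2.fderiv_eq]
  exact congrArg (fun L : EuclideanSpace ℝ (Fin n) →L[ℝ] EuclideanSpace ℝ (Fin n) => L v)
    (h1.trans h4)

/-- The derivative of the chart at its own centre is the identity, so transporting the coordinate
bracket back to the manifold changes nothing. -/
theorem mlieBracket_eq_lieBracket_chartField (X Y : Π y : N, TangentSpace (𝓡 n) y) (x : N) :
    mlieBracket (𝓡 n) X Y x =
      lieBracket ℝ (chartField X x) (chartField Y x) (extChartAt (𝓡 n) x x) := by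
  have : IsManifold (𝓡 n) 1 N := IsManifold.of_le (n := ∞) (by simp)
  have h3 : (extChartAt (𝓡 n) x).symm ⁻¹' univ ∩ range (𝓡 n) = univ := by simp
  have h4 : mlieBracket (𝓡 n) X Y x = (mfderiv (𝓡 n) 𝓘(ℝ, EuclideanSpace ℝ (Fin n))
      (extChartAt (𝓡 n) x) x).inverse (lieBracketWithin ℝ (chartField X x) (chartField Y x)
        ((extChartAt (𝓡 n) x).symm ⁻¹' univ ∩ range (𝓡 n)) (extChartAt (𝓡 n) x x)) := rfl
  have h8 : lieBracketWithin ℝ (chartField X x) (chartField Y x)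
      ((extChartAt (𝓡 n) x).symm ⁻¹' univ ∩ range (𝓡 n)) (extChartAt (𝓡 n) x x) =
      lieBracket ℝ (chartField X x) (chartField Y x) (extChartAt (𝓡 n) x x) := by
    rw [h3, lieBracketWithin_univ]
  have h5 := mfderiv_extChartAt_self (I := 𝓡 n) (x := x)
  have h6 := congrArg ContinuousLinearMap.inverse h5
  have h7 := h6.trans (ContinuousLinearMap.inverse_id (R := ℝ) (M := EuclideanSpace ℝ (Fin n)))
  exact h4.trans ((congrArg (fun L : EuclideanSpace ℝ (Fin n) →L[ℝ] EuclideanSpace ℝ (Fin n) =>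
    L _) h7).trans h8)

/-- The coordinate formula `[X, Y] = DY(X) - DX(Y)`; together with the symmetry of `Γ` it gives zero
torsion. -/
theorem compDeriv_sub_compDeriv {X Y : Π y : N, TangentSpace (𝓡 n) y} {x : N}
    (hX : SectionDiffAt n (fun z : N => z) X x) (hY : SectionDiffAt n (fun z : N => z) Y x) :
    compDeriv (fun z : N => z) Y x (X x) - compDeriv (fun z : N => z) X x (Y x) =
      mlieBracket (𝓡 n) X Y x := by
  rw [mlieBracket_eq_lieBracket_chartField, lieBracket_eq]
  simp only [chartField_self]
  exact congrArg₂ (fun a b : EuclideanSpace ℝ (Fin n) => a - b) (compDeriv_id_eq hY (X x))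
    (compDeriv_id_eq hX (Y x))

/-- The metric is a smooth section of `Hom(TN, Hom(TN, ℝ))`. The trivialization of that bundle
precomposes both arguments with the inverse trivialization of `TN`, which over the chart domain is
`metricCoord`. -/
theorem contMDiffAt_metricCoord (g : Metric n N) (x : N) :
    ContMDiffAt (𝓡 n) 𝓘(ℝ, EuclideanSpace ℝ (Fin n) →L[ℝ] EuclideanSpace ℝ (Fin n) →L[ℝ] ℝ) ∞
      (metricCoord g x) x := by
  have h := ((contMDiffAt_hom_bundle _).1 (g.contMDiff x)).2
  refine h.congr_of_eventuallyEq ?_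
  filter_upwards [(chartAt (EuclideanSpace ℝ (Fin n)) x).open_source.mem_nhds
    (mem_chart_source _ _)] with y hy
  have hy1 : y ∈ (trivializationAt (EuclideanSpace ℝ (Fin n)) (TangentSpace (𝓡 n)) x).baseSet := by
    simpa using hy
  have hy2 : y ∈ (trivializationAt (EuclideanSpace ℝ (Fin n) →L[ℝ] ℝ)
      (fun z : N => TangentSpace (𝓡 n) z →L[ℝ] Bundle.Trivial N ℝ z) x).baseSet :=
    ⟨hy1, mem_univ _⟩
  refine ContinuousLinearMap.ext fun u => ContinuousLinearMap.ext fun v => ?_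
  have h1 := Trivialization.continuousLinearMapAt_apply_of_mem ℝ
    (trivializationAt (EuclideanSpace ℝ (Fin n) →L[ℝ] ℝ)
      (fun z : N => TangentSpace (𝓡 n) z →L[ℝ] Bundle.Trivial N ℝ z) x) hy2
    (g.inner y ((trivializationAt (EuclideanSpace ℝ (Fin n)) (TangentSpace (𝓡 n)) x).symmL ℝ y u))
  refine Eq.trans ?_ (congrArg (fun L : EuclideanSpace ℝ (Fin n) →L[ℝ] ℝ => L v) h1).symm
  have h2 := Trivialization.continuousLinearMapAt_apply_of_mem ℝ
    (trivializationAt ℝ (Bundle.Trivial N ℝ) x) (mem_univ y)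
    (g.inner y ((trivializationAt (EuclideanSpace ℝ (Fin n)) (TangentSpace (𝓡 n)) x).symmL ℝ y u)
      ((trivializationAt (EuclideanSpace ℝ (Fin n)) (TangentSpace (𝓡 n)) x).symmL ℝ y v))
  exact h2.symm

theorem metricCoord_self (g : Metric n N) (x : N) (u v : EuclideanSpace ℝ (Fin n)) :
    metricCoord g x x u v = g.inner x (u : TangentSpace (𝓡 n) x) (v : TangentSpace (𝓡 n) x) := by
  have : IsManifold (𝓡 n) 1 N := IsManifold.of_le (n := ∞) (by simp)
  have hS : ∀ u : EuclideanSpace ℝ (Fin n),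
      (trivializationAt (EuclideanSpace ℝ (Fin n)) (TangentSpace (𝓡 n)) x).symmL ℝ x u =
        (u : TangentSpace (𝓡 n) x) := fun u => by
    have h := Trivialization.symmL_continuousLinearMapAt
      (trivializationAt (EuclideanSpace ℝ (Fin n)) (TangentSpace (𝓡 n)) x)
      (R := ℝ) (mem_baseSet_trivializationAt _ _ x) (u : TangentSpace (𝓡 n) x)
    have h' := (Trivialization.continuousLinearMapAt_apply_of_mem ℝ
      (trivializationAt (EuclideanSpace ℝ (Fin n)) (TangentSpace (𝓡 n)) x)
      (mem_baseSet_trivializationAt _ _ x) (u : TangentSpace (𝓡 n) x)).trans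
      (trivializationAt_self_snd x u)
    exact (congrArg _ h').symm.trans h
  unfold metricCoord
  change g.inner x ((trivializationAt (EuclideanSpace ℝ (Fin n)) (TangentSpace (𝓡 n)) x).symmL ℝ
    x u) ((trivializationAt (EuclideanSpace ℝ (Fin n)) (TangentSpace (𝓡 n)) x).symmL ℝ x v) = _
  rw [hS, hS]

/-- Writes `g(Y, Z)` near `x` as a varying bilinear form on two varying vectors of `ℝⁿ`, the shape
to which the product rule applies. -/
theorem metricCoord_sectionCoord (g : Metric n N) (x : N) {y : N}
    (hy : y ∈ (chartAt (EuclideanSpace ℝ (Fin n)) x).source)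
    (Y Z : Π y : N, TangentSpace (𝓡 n) y) :
    metricCoord g x y (sectionCoord (fun z : N => z) Y x y) (sectionCoord (fun z : N => z) Z x y) =
      g.inner y (Y y) (Z y) := by
  have hy' : y ∈ (trivializationAt (EuclideanSpace ℝ (Fin n)) (TangentSpace (𝓡 n)) x).baseSet := by
    simpa using hy
  have hS : ∀ W : Π y : N, TangentSpace (𝓡 n) y,
      (trivializationAt (EuclideanSpace ℝ (Fin n)) (TangentSpace (𝓡 n)) x).symmL ℝ y
        (sectionCoord (fun z : N => z) W x y) = W y := fun W => by
    have h := Trivialization.symmL_continuousLinearMapAt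
      (trivializationAt (EuclideanSpace ℝ (Fin n)) (TangentSpace (𝓡 n)) x)
      (R := ℝ) hy' (W y)
    rwa [Trivialization.continuousLinearMapAt_apply_of_mem ℝ _ hy'] at h
  unfold metricCoord
  change g.inner y ((trivializationAt (EuclideanSpace ℝ (Fin n)) (TangentSpace (𝓡 n)) x).symmL ℝ
    y _) ((trivializationAt (EuclideanSpace ℝ (Fin n)) (TangentSpace (𝓡 n)) x).symmL ℝ y _) = _
  rw [hS, hS]

set_option synthInstance.maxHeartbeats 200000 in
theorem metricDeriv_apply (g : Metric n N) (x : N) (v a b : EuclideanSpace ℝ (Fin n)) :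
    metricDeriv g x v a b = mfderiv (𝓡 n) 𝓘(ℝ, ℝ) (fun y => metricCoord g x y a b) x v := by
  have h0 : MDifferentiableAt (𝓡 n) 𝓘(ℝ, EuclideanSpace ℝ (Fin n) →L[ℝ]
      EuclideanSpace ℝ (Fin n) →L[ℝ] ℝ) (metricCoord g x) x :=
    (contMDiffAt_metricCoord g x).mdifferentiableAt (by simp)
  have h1 := hasMFDerivAt_bilinear (ContinuousLinearMap.id ℝ (EuclideanSpace ℝ (Fin n) →L[ℝ]
    EuclideanSpace ℝ (Fin n) →L[ℝ] ℝ)) h0.hasMFDerivAt (hasMFDerivAt_const a x)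
  have h2 := hasMFDerivAt_bilinear (ContinuousLinearMap.id ℝ (EuclideanSpace ℝ (Fin n) →L[ℝ] ℝ))
    h1 (hasMFDerivAt_const b x)
  have h3 := congrArg (fun L : EuclideanSpace ℝ (Fin n) →L[ℝ] ℝ => L v) h2.mfderiv
  refine Eq.trans ?_ h3.symm
  have e1 : ∀ L : EuclideanSpace ℝ (Fin n) →L[ℝ] ℝ, L 0 = 0 := fun L => map_zero L
  have e2 : ∀ L : EuclideanSpace ℝ (Fin n) →L[ℝ] EuclideanSpace ℝ (Fin n) →L[ℝ] ℝ, L 0 b = 0 :=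
    fun L => congrArg (fun l : EuclideanSpace ℝ (Fin n) →L[ℝ] ℝ => l b) (map_zero L)
  change _ = metricCoord g x x a 0 + (metricCoord g x x 0 b + metricDeriv g x v a b)
  rw [e1, e2, zero_add, zero_add]

/-- The metric is symmetric at every nearby point, and evaluation on fixed vectors commutes with the
derivative. -/
theorem metricDeriv_symm (g : Metric n N) (x : N) (v a b : EuclideanSpace ℝ (Fin n)) :
    metricDeriv g x v a b = metricDeriv g x v b a := by
  rw [metricDeriv_apply, metricDeriv_apply]
  congr 2
  ext y
  exact g.symm y _ _

theorem inner_christoffel (g : Metric n N) (x : N) (u v z : EuclideanSpace ℝ (Fin n)) :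
    g.inner x (christoffel g x u v : TangentSpace (𝓡 n) x) (z : TangentSpace (𝓡 n) x) =
      christoffelLower g x u v z := by
  have h := LinearEquiv.apply_symm_apply
    ((metricForm g x).toDual (metricForm_nondegenerate g x))
    (christoffelLower g x u v : EuclideanSpace ℝ (Fin n) →ₗ[ℝ] ℝ)
  exact congrArg (fun L : EuclideanSpace ℝ (Fin n) →ₗ[ℝ] ℝ => L z) h

/-- Exchanging `u` and `v` swaps the first two terms of the lower symbol and fixes the third by
symmetry of the metric. -/
theorem christoffel_symm (g : Metric n N) (x : N) (u v : EuclideanSpace ℝ (Fin n)) :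
    christoffel g x u v = christoffel g x v u := by
  unfold christoffel
  congr 1
  refine LinearMap.ext fun z => ?_
  change christoffelLower g x u v z = christoffelLower g x v u z
  rw [christoffelLower_eq, christoffelLower_eq, metricDeriv_symm g x z u v, add_comm]

/-- The Levi-Civita connection is torsion-free. -/
theorem leviCivita_sub_leviCivita (g : Metric n N) {X Y : Π y : N, TangentSpace (𝓡 n) y} {x : N}
    (hX : SectionDiffAt n (fun z : N => z) X x) (hY : SectionDiffAt n (fun z : N => z) Y x) :
    leviCivita g Y x (X x) - leviCivita g X x (Y x) = mlieBracket (𝓡 n) X Y x := by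
  rw [← compDeriv_sub_compDeriv hX hY]
  unfold leviCivita
  rw [christoffel_symm g x (Y x) (X x)]
  exact add_sub_add_right_eq_sub (G := EuclideanSpace ℝ (Fin n)) _ _ _

set_option synthInstance.maxHeartbeats 200000 in
/-- The Levi-Civita connection is compatible with the metric. -/
theorem vecDeriv_inner (g : Metric n N) {Y Z : Π y : N, TangentSpace (𝓡 n) y} {x : N}
    (hY : SectionDiffAt n (fun z : N => z) Y x) (hZ : SectionDiffAt n (fun z : N => z) Z x)
    (v : TangentSpace (𝓡 n) x) :
    vecDeriv (fun y => g.inner y (Y y) (Z y)) x v =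
      g.inner x (leviCivita g Y x v) (Z x) + g.inner x (Y x) (leviCivita g Z x v) := by
  have h0 : MDifferentiableAt (𝓡 n) 𝓘(ℝ, EuclideanSpace ℝ (Fin n) →L[ℝ]
      EuclideanSpace ℝ (Fin n) →L[ℝ] ℝ) (metricCoord g x) x :=
    (contMDiffAt_metricCoord g x).mdifferentiableAt (by simp)
  have h1 := hasMFDerivAt_bilinear (ContinuousLinearMap.id ℝ (EuclideanSpace ℝ (Fin n) →L[ℝ]
    EuclideanSpace ℝ (Fin n) →L[ℝ] ℝ)) h0.hasMFDerivAt hY.hasMFDerivAt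
  have h2 := hasMFDerivAt_bilinear (ContinuousLinearMap.id ℝ (EuclideanSpace ℝ (Fin n) →L[ℝ] ℝ))
    h1 hZ.hasMFDerivAt
  have h3 : (fun y => g.inner y (Y y) (Z y)) =ᶠ[𝓝 x] fun y => metricCoord g x y
      (sectionCoord (fun z : N => z) Y x y) (sectionCoord (fun z : N => z) Z x y) := by
    filter_upwards [(chartAt (EuclideanSpace ℝ (Fin n)) x).open_source.mem_nhds
      (mem_chart_source _ _)] with y hy
    rw [metricCoord_sectionCoord g x hy]
  -- The tangent vectors at `x` are regarded as elements of `ℝⁿ`, where the bilinear forms of the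
  -- chart live.
  obtain ⟨a, ha⟩ : ∃ a : EuclideanSpace ℝ (Fin n), a = Y x := ⟨_, rfl⟩
  obtain ⟨b, hb⟩ : ∃ b : EuclideanSpace ℝ (Fin n), b = Z x := ⟨_, rfl⟩
  obtain ⟨w, hw⟩ : ∃ w : EuclideanSpace ℝ (Fin n), w = v := ⟨_, rfl⟩
  obtain ⟨a', ha'⟩ : ∃ a' : EuclideanSpace ℝ (Fin n), a' = compDeriv (fun z : N => z) Y x v :=
    ⟨_, rfl⟩
  obtain ⟨b', hb'⟩ : ∃ b' : EuclideanSpace ℝ (Fin n), b' = compDeriv (fun z : N => z) Z x v :=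
    ⟨_, rfl⟩
  have h4 : vecDeriv (fun y => g.inner y (Y y) (Z y)) x v =
      metricCoord g x x a b' + (metricCoord g x x a' b + metricDeriv g x w a b) := by
    rw [vecDeriv_congr h3, ha, hb, ha', hb', hw]
    have e := congrArg (fun L : EuclideanSpace ℝ (Fin n) →L[ℝ] ℝ => L v) h2.mfderiv
    rw [sectionCoord_self, sectionCoord_self] at e
    exact e
  have h5 : g.inner x (leviCivita g Y x v) (Z x) =
      metricCoord g x x a' b + christoffelLower g x w a b := by
    rw [metricCoord_self, ← inner_christoffel]
    unfold leviCivita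
    rw [← ha', ← ha, ← hb, ← hw]
    exact congrArg (fun L : EuclideanSpace ℝ (Fin n) →L[ℝ] ℝ => L b)
      ((g.inner x).map_add (a' : TangentSpace (𝓡 n) x)
        (christoffel g x w a : TangentSpace (𝓡 n) x))
  have h6 : g.inner x (Y x) (leviCivita g Z x v) =
      metricCoord g x x a b' + christoffelLower g x w b a := by
    have e : christoffelLower g x w b a = g.inner x (a : TangentSpace (𝓡 n) x)
        (christoffel g x w b : TangentSpace (𝓡 n) x) :=
      (inner_christoffel g x w b a).symm.trans (g.symm x _ _)
    rw [metricCoord_self, e]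
    unfold leviCivita
    rw [← hb', ← ha, ← hb, ← hw]
    exact (g.inner x (a : TangentSpace (𝓡 n) x)).map_add (b' : TangentSpace (𝓡 n) x)
      (christoffel g x w b : TangentSpace (𝓡 n) x)
  -- `Γ(w, a; b) + Γ(w, b; a) = D_w g(a, b)` for the lower symbols: the other four terms cancel in
  -- pairs by symmetry.
  rw [h4, h5, h6, christoffelLower_eq, christoffelLower_eq, metricDeriv_symm g x w b a,
    metricDeriv_symm g x b w a, metricDeriv_symm g x a w b]
  ring

end LeviCivita

/-! ### Smooth fields and the commutator formula for Lie brackets. -/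

section Commutator

variable {n : ℕ}
  {N : Type*} [TopologicalSpace N] [ChartedSpace (EuclideanSpace ℝ (Fin n)) N]
  [IsManifold (𝓡 n) ∞ N]

theorem IsSmoothFieldOn.contMDiffAt {X : Π y : N, TangentSpace (𝓡 n) y} {W : Set N}
    (hX : IsSmoothFieldOn X W) (hW : IsOpen W) {y : N} (hy : y ∈ W) :
    ContMDiffAt (𝓡 n) (𝓡 n).tangent ∞ (fun x => (⟨x, X x⟩ : TangentBundle (𝓡 n) N)) y :=
  ContMDiffOn.contMDiffAt hX (hW.mem_nhds hy)

theorem IsSmoothFieldOn.sectionDiffAt {X : Π y : N, TangentSpace (𝓡 n) y} {W : Set N}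
    (hX : IsSmoothFieldOn X W) (hW : IsOpen W) {y : N} (hy : y ∈ W) :
    SectionDiffAt n (fun z : N => z) X y :=
  sectionDiffAt_id_iff.2 ((hX.contMDiffAt hW hy).mdifferentiableAt (by simp))

theorem contMDiffOn_inner (g : Metric n N) {X Y : Π y : N, TangentSpace (𝓡 n) y} {W : Set N}
    (hX : IsSmoothFieldOn X W) (hY : IsSmoothFieldOn Y W) :
    ContMDiffOn (𝓡 n) 𝓘(ℝ, ℝ) ∞ (fun y => g.inner y (X y) (Y y)) W := by
  have h := ContMDiffOn.clm_bundle_apply₂ (E₃ := Bundle.Trivial N ℝ) (F₃ := ℝ)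
    (g.contMDiff.contMDiffOn (s := W)) hX hY
  intro y hy
  have h1 := (contMDiffWithinAt_totalSpace.1 (h y hy)).2
  exact h1

theorem isSmoothFieldOn_ext {x : N} (v : TangentSpace (𝓡 n) x) :
    IsSmoothFieldOn (ext v) (chartAt (EuclideanSpace ℝ (Fin n)) x).source := by
  set t := trivializationAt (EuclideanSpace ℝ (Fin n)) (TangentSpace (𝓡 n)) x with ht
  have h : ContMDiffOn (𝓡 n) 𝓘(ℝ, EuclideanSpace ℝ (Fin n)) ∞
      (fun y => (t (⟨y, ext v y⟩ : TangentBundle (𝓡 n) N)).2) t.baseSet := by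
    refine (contMDiffOn_const (c := (t (⟨x, v⟩ : TangentBundle (𝓡 n) N)).2)).congr fun y hy => ?_
    have := congrArg Prod.snd (t.apply_mk_symm hy (t (⟨x, v⟩ : TangentBundle (𝓡 n) N)).2)
    exact this
  intro y hy
  have hy' : y ∈ t.baseSet := by simpa [ht] using hy
  have hb : t.baseSet = (chartAt (EuclideanSpace ℝ (Fin n)) x).source := by simp [ht]
  rw [t.contMDiffWithinAt_section _ hy', ← hb]
  exact h y hy'

theorem ext_self {x : N} (v : TangentSpace (𝓡 n) x) : ext v x = v :=
  FiberBundle.extend_apply_self _ v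

theorem mlieBracket_smul_field {X Z : Π y : N, TangentSpace (𝓡 n) y} {u : N → ℝ} {y : N}
    (hu : MDifferentiableAt (𝓡 n) 𝓘(ℝ, ℝ) u y)
    (hZ : MDifferentiableAt (𝓡 n) (𝓡 n).tangent
      (fun x => (⟨x, Z x⟩ : TangentBundle (𝓡 n) N)) y) :
    mlieBracket (𝓡 n) X (fun x => u x • Z x) y =
      vecDeriv u y (X y) • Z y + u y • mlieBracket (𝓡 n) X Z y := by
  have : IsManifold (𝓡 n) (minSmoothness ℝ 3) N := by
    rw [minSmoothness_of_isRCLikeNormedField]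
    exact IsManifold.of_le (n := ∞) (ENat.LEInfty.out (m := 3))
  exact mlieBracket_smul_right hu hZ

/-- The Lie bracket acts on functions as the commutator of derivations. -/
theorem vecDeriv_dirDeriv_sub {X Y Z : Π y : N, TangentSpace (𝓡 n) y} {W : Set N} (hW : IsOpen W)
    (hX : IsSmoothFieldOn X W) (hY : IsSmoothFieldOn Y W) (hZ : IsSmoothFieldOn Z W) {u : N → ℝ}
    (hu : ContMDiffOn (𝓡 n) 𝓘(ℝ, ℝ) ∞ u W) {y : N} (hy : y ∈ W) (hZy : Z y ≠ 0) :
    vecDeriv (dirDeriv Y u) y (X y) - vecDeriv (dirDeriv X u) y (Y y) =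
      vecDeriv u y (mlieBracket (𝓡 n) X Y y) := by
  have i3 : IsManifold (𝓡 n) (minSmoothness ℝ 3) N := by
    rw [minSmoothness_of_isRCLikeNormedField]
    exact IsManifold.of_le (n := ∞) (ENat.LEInfty.out (m := 3))
  have i1 : IsManifold (𝓡 n) 1 N := IsManifold.of_le (n := ∞) (by simp)
  have i2 : IsManifold (𝓡 n) (((⊤ : ℕ∞) : WithTop ℕ∞) + 1) N := by simpa
  have h2 : minSmoothness ℝ 2 ≤ (∞ : WithTop ℕ∞) := by
    rw [minSmoothness_of_isRCLikeNormedField]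
    exact ENat.LEInfty.out (m := 2)
  have hm : minSmoothness ℝ (((⊤ : ℕ∞) : WithTop ℕ∞) + 1) ≤ ((⊤ : ℕ∞) : WithTop ℕ∞) := by
    rw [minSmoothness_of_isRCLikeNormedField]
    simp
  have hd : ∀ {f : N → ℝ}, ContMDiffOn (𝓡 n) 𝓘(ℝ, ℝ) ∞ f W → ∀ p ∈ W,
      MDifferentiableAt (𝓡 n) 𝓘(ℝ, ℝ) f p := fun hf p hp =>
    (hf.contMDiffAt (hW.mem_nhds hp)).mdifferentiableAt (by simp)
  have hD : ∀ {A : Π y : N, TangentSpace (𝓡 n) y}, IsSmoothFieldOn A W → ∀ p ∈ W,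
      MDifferentiableAt (𝓡 n) (𝓡 n).tangent (fun x => (⟨x, A x⟩ : TangentBundle (𝓡 n) N)) p :=
    fun hA p hp => (hA.contMDiffAt hW hp).mdifferentiableAt (by simp)
  have hbr : ∀ {A : Π y : N, TangentSpace (𝓡 n) y}, IsSmoothFieldOn A W →
      IsSmoothFieldOn (mlieBracket (𝓡 n) A Z) W := fun hA p hp =>
    (ContMDiffAt.mlieBracket_vectorField (hA.contMDiffAt hW hp) (hZ.contMDiffAt hW hp)
      hm).contMDiffWithinAt
  -- Leibniz rule twice on `[A, [B, uZ]]`. The cross terms `A(u) [B, Z] + B(u) [A, Z]` are symmetric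
  -- in `A`, `B` and drop out of the antisymmetrization.
  have hin : ∀ {A B : Π y : N, TangentSpace (𝓡 n) y}, IsSmoothFieldOn A W → IsSmoothFieldOn B W →
      mlieBracket (𝓡 n) A (mlieBracket (𝓡 n) B (fun x => u x • Z x)) y =
        (vecDeriv (dirDeriv B u) y (A y) • Z y
          + dirDeriv B u y • mlieBracket (𝓡 n) A Z y)
        + (vecDeriv u y (A y) • mlieBracket (𝓡 n) B Z y
          + u y • mlieBracket (𝓡 n) A (mlieBracket (𝓡 n) B Z) y) := by
    intro A B hA hB
    have hBu := contMDiffOn_dirDeriv hW hB hu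
    have e : mlieBracket (𝓡 n) B (fun x => u x • Z x) =ᶠ[𝓝 y]
        (fun x => dirDeriv B u x • Z x) + (fun x => u x • mlieBracket (𝓡 n) B Z x) := by
      filter_upwards [hW.mem_nhds hy] with p hp
      exact mlieBracket_smul_field (hd hu p hp) (hD hZ p hp)
    rw [Filter.EventuallyEq.mlieBracket_vectorField_eq (EventuallyEq.refl _ A) e,
      mlieBracket_add_right, mlieBracket_smul_field (hd hBu y hy) (hD hZ y hy),
      mlieBracket_smul_field (hd hu y hy) (hD (hbr hB) y hy)]
    · exact (hd hBu y hy).smul_section (hD hZ y hy)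
    · exact (hd hu y hy).smul_section (hD (hbr hB) y hy)
  have huZ : IsSmoothFieldOn (fun x => u x • Z x) W := hu.smul_section hZ
  -- The Jacobi identity for `X, Y, uZ` minus `u` times the one for `X, Y, Z` leaves `(X(Y u) - Y(X
  -- u) - [X, Y] u) Z = 0`. The auxiliary `Z` must not vanish at `y` for its coefficient to be read
  -- off.
  have key := leibniz_identity_mlieBracket_apply (I := 𝓡 n) (U := X) (V := Y)
    (W := fun x => u x • Z x) ((hX.contMDiffAt hW hy).of_le h2) ((hY.contMDiffAt hW hy).of_le h2)
    ((huZ.contMDiffAt hW hy).of_le h2)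
  have key' := leibniz_identity_mlieBracket_apply (I := 𝓡 n) (U := X) (V := Y)
    (W := Z) ((hX.contMDiffAt hW hy).of_le h2) ((hY.contMDiffAt hW hy).of_le h2)
    ((hZ.contMDiffAt hW hy).of_le h2)
  rw [hin hX hY, hin hY hX, mlieBracket_smul_field (hd hu y hy) (hD hZ y hy), key'] at key
  have h0 : (vecDeriv (dirDeriv Y u) y (X y) - vecDeriv (dirDeriv X u) y (Y y)
      - vecDeriv u y (mlieBracket (𝓡 n) X Y y)) • Z y = 0 := by
    have e1 : dirDeriv X u y = vecDeriv u y (X y) := rfl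
    have e2 : dirDeriv Y u y = vecDeriv u y (Y y) := rfl
    rw [e1, e2] at key
    refine Eq.trans ?_ (sub_eq_zero.2 key)
    module
  have := (smul_eq_zero.1 h0).resolve_right hZy
  linarith

end Commutator

/-! ### The metric trace and the inverse Gram matrix. -/

section Trace

variable {n : ℕ}
  {M : Type*} [TopologicalSpace M] [ChartedSpace (EuclideanSpace ℝ (Fin n)) M]
  [IsManifold (𝓡 n) ∞ M]

/-- The Gram matrix of the metric in the standard basis of the tangent space. -/
theorem gram_det_ne_zero (g : Metric n M) (x : M) :
    (Matrix.of fun a b : Fin n => metricForm g x (EuclideanSpace.single a 1)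
      (EuclideanSpace.single b 1)).det ≠ 0 := by
  intro h
  -- A kernel vector `c` of the Gram matrix would give a nonzero `w = ∑ c_b b_b` with `g(w, w) = 0`.
  obtain ⟨c, hc, h0⟩ := Matrix.exists_mulVec_eq_zero_iff.2 h
  have hw : (∑ b, c b • EuclideanSpace.single b (1 : ℝ) : EuclideanSpace ℝ (Fin n)) ≠ 0 := by
    intro hw
    apply hc
    ext i
    simpa [Finset.sum_apply, Pi.single_apply] using congrArg (fun v : EuclideanSpace ℝ (Fin n) => v i) hw
  have h1 : ∀ a, metricForm g x (EuclideanSpace.single a 1)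
      (∑ b, c b • EuclideanSpace.single b (1 : ℝ)) = 0 := fun a => by
    have := congrFun h0 a
    simp only [Matrix.mulVec, dotProduct, Matrix.of_apply, Pi.zero_apply] at this
    rw [map_sum, ← this]
    refine Finset.sum_congr rfl fun b _ => ?_
    rw [map_smul, smul_eq_mul, mul_comm]
  have h2 : metricForm g x (∑ b, c b • EuclideanSpace.single b (1 : ℝ))
      (∑ b, c b • EuclideanSpace.single b (1 : ℝ)) = 0 := by
    conv_lhs => enter [1]; rw [map_sum]
    rw [LinearMap.sum_apply]
    refine Finset.sum_eq_zero fun a _ => ?_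
    rw [map_smul, LinearMap.smul_apply, h1, smul_zero]
  exact (g.pos x _ hw).ne' h2

/-- The numbers `g(b_j, w)` form the vector `G w`, so applying `G⁻¹` recovers the coordinates of
`w`. -/
theorem sum_gram_inv_smul (g : Metric n M) (x : M) (w : EuclideanSpace ℝ (Fin n)) :
    ∑ i, ∑ j, ((Matrix.of fun a b : Fin n => metricForm g x (EuclideanSpace.single a 1)
      (EuclideanSpace.single b 1))⁻¹ i j * metricForm g x (EuclideanSpace.single j 1) w) •
        (EuclideanSpace.single i (1 : ℝ) : EuclideanSpace ℝ (Fin n)) = w := by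
  set G := Matrix.of fun a b : Fin n => metricForm g x (EuclideanSpace.single a 1)
      (EuclideanSpace.single b 1) with hG
  have hw : w = ∑ b, w b • EuclideanSpace.single b (1 : ℝ) := by
    ext i
    simp [Finset.sum_apply, Pi.single_apply]
  have h1 : ∀ j, metricForm g x (EuclideanSpace.single j 1) w = (G.mulVec w) j := fun j => by
    conv_lhs => rw [hw]
    rw [map_sum]
    simp only [Matrix.mulVec, dotProduct, hG, Matrix.of_apply]
    refine Finset.sum_congr rfl fun b _ => ?_
    rw [map_smul, smul_eq_mul, mul_comm]
  have h2 : ∀ i, ∑ j, G⁻¹ i j * (G.mulVec w) j = w i := fun i => by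
    have : (G⁻¹.mulVec (G.mulVec w)) i = w i := by
      rw [Matrix.mulVec_mulVec, Matrix.nonsing_inv_mul _ (isUnit_iff_ne_zero.2
        (gram_det_ne_zero g x)), Matrix.one_mulVec]
    exact this
  simp only [h1, ← Finset.sum_smul, h2]
  exact hw.symm

/-- The trace of a bilinear expression, computed in an arbitrary frame in which the second
argument has been expanded. -/
theorem metricTrace_eq_sum (g : Metric n M) (x : M) {F : Type*} [AddCommGroup F] [Module ℝ F]
    {ι : Type} [Fintype ι] (w : ι → EuclideanSpace ℝ (Fin n))
    (C : ι → EuclideanSpace ℝ (Fin n) →ₗ[ℝ] F)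
    (B : TangentSpace (𝓡 n) x → TangentSpace (𝓡 n) x → F)
    (hB : ∀ u v : EuclideanSpace ℝ (Fin n), B u v = ∑ k, metricForm g x v (w k) • C k u) :
    metricTrace g x B = ∑ k, C k (w k) := by
  unfold metricTrace
  have h : ∀ i j : Fin n, B (EuclideanSpace.single i (1 : ℝ) : EuclideanSpace ℝ (Fin n))
      (EuclideanSpace.single j (1 : ℝ) : EuclideanSpace ℝ (Fin n)) = _ := fun i j => hB _ _
  simp only [h, Finset.smul_sum, smul_smul]
  simp_rw [Finset.sum_comm (s := (Finset.univ : Finset (Fin n))) (t := (Finset.univ : Finset ι))]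
  refine Finset.sum_congr rfl fun k _ => ?_
  conv_rhs => rw [← sum_gram_inv_smul g x (w k)]
  simp only [map_sum, map_smul]

/-- `n` vectors orthonormal for `B` are independent, hence a basis in dimension `n`; pairing with `e
i` then isolates the coefficients. -/
theorem orthonormal_expansion {F : Type*} [AddCommGroup F] [Module ℝ F] [FiniteDimensional ℝ F]
    (hF : Module.finrank ℝ F = n) (B : LinearMap.BilinForm ℝ F) {e : Fin n → F}
    (he : ∀ i j, B (e i) (e j) = if i = j then 1 else 0) (v : F) :
    v = ∑ i, B v (e i) • e i := by
  have hli : LinearIndependent ℝ e :=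
    LinearMap.BilinForm.linearIndependent_of_iIsOrtho (B := B)
      (LinearMap.BilinForm.iIsOrtho_def.2 fun i j hij => (he i j).trans (if_neg hij))
      fun i => by rw [he i i, if_pos rfl]; exact one_ne_zero
  have hsp := hli.span_eq_top_of_card_eq_finrank' (by simp [hF])
  have hv : v ∈ Submodule.span ℝ (Set.range e) := by
    rw [hsp]; trivial
  obtain ⟨c, rfl⟩ := (Submodule.mem_span_range_iff_exists_fun ℝ).1 hv
  refine Finset.sum_congr rfl fun i _ => ?_
  simp [he]

/-- A tangent vector is the combination of the vectors of an orthonormal basis. -/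
theorem frame_expansion (g : Metric n M) {x : M} {e : Fin n → TangentSpace (𝓡 n) x}
    (he : ∀ i j, g.inner x (e i) (e j) = if i = j then 1 else 0) (v : TangentSpace (𝓡 n) x) :
    v = ∑ i, g.inner x v (e i) • e i :=
  orthonormal_expansion (F := EuclideanSpace ℝ (Fin n)) (by simp) (metricForm g x) he v

end Trace

/-! ### Connection and traces in an orthonormal frame. -/

section OrthonormalFrame

variable {m n : ℕ}
  {M : Type*} [TopologicalSpace M] [ChartedSpace (EuclideanSpace ℝ (Fin m)) M]
  [IsManifold (𝓡 m) ∞ M]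
  {N : Type*} [TopologicalSpace N] [ChartedSpace (EuclideanSpace ℝ (Fin n)) N]
  [IsManifold (𝓡 n) ∞ N]

theorem leviCivita_add_right (g : Metric m M) (X : Π x : M, TangentSpace (𝓡 m) x) (x : M)
    (v w : TangentSpace (𝓡 m) x) :
    leviCivita g X x (v + w) = leviCivita g X x v + leviCivita g X x w := by
  simp only [leviCivita_eq_inducedConn]
  exact inducedConn_add_right g (fun z : M => z) X x v w

theorem leviCivita_smul_right (g : Metric m M) (X : Π x : M, TangentSpace (𝓡 m) x) (x : M)
    (a : ℝ) (v : TangentSpace (𝓡 m) x) :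
    leviCivita g X x (a • v) = a • leviCivita g X x v := by
  simp only [leviCivita_eq_inducedConn]
  exact inducedConn_smul_right g (fun z : M => z) X x a v

theorem leviCivita_congr (g : Metric m M) {X Y : Π x : M, TangentSpace (𝓡 m) x} {x : M}
    (hXY : ∀ᶠ y in 𝓝 x, X y = Y y) (v : TangentSpace (𝓡 m) x) :
    leviCivita g X x v = leviCivita g Y x v := by
  simp only [leviCivita_eq_inducedConn]
  exact inducedConn_congr g hXY v

/-- The induced connection `v ↦ ∇^φ_v V` as a linear map. -/
noncomputable def inducedConnLin (h : Metric n N) (φ : M → N)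
    (V : Π x : M, TangentSpace (𝓡 n) (φ x)) (x : M) :
    TangentSpace (𝓡 m) x →ₗ[ℝ] TangentSpace (𝓡 n) (φ x) where
  toFun := inducedConn h φ V x
  map_add' := inducedConn_add_right h φ V x
  map_smul' := inducedConn_smul_right h φ V x

/-- The differential of a function as a linear map. -/
noncomputable def vecDerivLin (u : M → ℝ) (x : M) : TangentSpace (𝓡 m) x →ₗ[ℝ] ℝ where
  toFun := vecDeriv u x
  map_add' := vecDeriv_add_right u x
  map_smul' := vecDeriv_smul_right u x

/-- The differential of a map as a linear map. -/
noncomputable def mfderivLin (φ : M → N) (x : M) :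
    TangentSpace (𝓡 m) x →ₗ[ℝ] TangentSpace (𝓡 n) (φ x) where
  toFun := mfderiv (𝓡 m) (𝓡 n) φ x
  map_add' := map_add (mfderiv (𝓡 m) (𝓡 n) φ x)
  map_smul' := map_smul (mfderiv (𝓡 m) (𝓡 n) φ x)

variable {g : Metric m M} {e : Fin m → Π x : M, TangentSpace (𝓡 m) x} {U : Set M}

theorem IsOrthonormalFrameOn.sectionDiffAt (he : IsOrthonormalFrameOn g e U) (hU : IsOpen U)
    {x : M} (hx : x ∈ U) (i : Fin m) : SectionDiffAt m (fun z : M => z) (e i) x :=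
  (he.smooth i).sectionDiffAt hU hx

theorem IsOrthonormalFrameOn.expansion (he : IsOrthonormalFrameOn g e U) {x : M} (hx : x ∈ U)
    (v : TangentSpace (𝓡 m) x) : v = ∑ i, g.inner x v (e i x) • e i x :=
  frame_expansion g (he.orthonormal x hx) v

/-- Metric compatibility applied to the locally constant function `g(eᵢ, eⱼ)`. -/
theorem IsOrthonormalFrameOn.inner_leviCivita_add (he : IsOrthonormalFrameOn g e U)
    (hU : IsOpen U) {x : M} (hx : x ∈ U) (i j : Fin m) (v : TangentSpace (𝓡 m) x) :
    g.inner x (leviCivita g (e i) x v) (e j x) + g.inner x (e i x) (leviCivita g (e j) x v) = 0 := by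
  rw [← vecDeriv_inner g (he.sectionDiffAt hU hx i) (he.sectionDiffAt hU hx j)]
  rw [← vecDeriv_const (if i = j then (1 : ℝ) else 0) x v]
  refine vecDeriv_congr ?_ v
  filter_upwards [hU.mem_nhds hx] with y hy
  exact he.orthonormal y hy i j

theorem IsOrthonormalFrameOn.inner_leviCivita_self (he : IsOrthonormalFrameOn g e U)
    (hU : IsOpen U) {x : M} (hx : x ∈ U) (i : Fin m) (v : TangentSpace (𝓡 m) x) :
    g.inner x (leviCivita g (e i) x v) (e i x) = 0 := by
  have h := he.inner_leviCivita_add hU hx i i v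
  rw [g.symm x (e i x)] at h
  linarith

/-- The case of the Koszul formula needed for traces: `g(∇_{eᵢ}eᵢ, eⱼ) = -g(eᵢ, ∇_{eᵢ}eⱼ)`,
torsion-freeness replaces `∇_{eᵢ}eⱼ` by `[eᵢ, eⱼ] + ∇_{eⱼ}eᵢ`, and `g(eᵢ, ∇_{eⱼ}eᵢ) = 0`. -/
theorem IsOrthonormalFrameOn.inner_leviCivita_eq_bracket (he : IsOrthonormalFrameOn g e U)
    (hU : IsOpen U) {x : M} (hx : x ∈ U) (i j : Fin m) :
    g.inner x (leviCivita g (e i) x (e i x)) (e j x) =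
      -g.inner x (mlieBracket (𝓡 m) (e i) (e j) x) (e i x) := by
  have h1 := he.inner_leviCivita_add hU hx i j (e i x)
  have h2 := leviCivita_sub_leviCivita g (he.sectionDiffAt hU hx i) (he.sectionDiffAt hU hx j)
  have h3 := he.inner_leviCivita_self hU hx i (e j x)
  rw [← h2, map_sub, sub_apply, h3, g.symm x (leviCivita g (e j) x (e i x))]
  linarith

/-- The coefficients of a vector field in an orthonormal frame. -/
theorem IsOrthonormalFrameOn.contMDiffOn_coeff (he : IsOrthonormalFrameOn g e U)
    {X : Π x : M, TangentSpace (𝓡 m) x} {W : Set M} (hW : W ⊆ U) (hX : IsSmoothFieldOn X W)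
    (i : Fin m) : ContMDiffOn (𝓡 m) 𝓘(ℝ, ℝ) ∞ (fun y => g.inner y (X y) (e i y)) W :=
  contMDiffOn_inner g hX ((he.smooth i).mono hW)

theorem IsOrthonormalFrameOn.leviCivita_eq_sum (he : IsOrthonormalFrameOn g e U) (hU : IsOpen U)
    {X : Π x : M, TangentSpace (𝓡 m) x} {W : Set M} (hW : IsOpen W) (hX : IsSmoothFieldOn X W)
    {x : M} (hx : x ∈ U) (hxW : x ∈ W) (v : TangentSpace (𝓡 m) x) :
    leviCivita g X x v = ∑ i, (vecDeriv (fun y => g.inner y (X y) (e i y)) x v • e i x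
      + g.inner x (X x) (e i x) • leviCivita g (e i) x v) := by
  have h1 : ∀ᶠ y in 𝓝 x, X y = ∑ i, g.inner y (X y) (e i y) • e i y := by
    filter_upwards [hU.mem_nhds hx] with y hy
    exact he.expansion hy (X y)
  rw [leviCivita_congr g h1]
  simp only [leviCivita_eq_inducedConn]
  refine inducedConn_sum g (fun z : M => z) Finset.univ (a := fun i y => g.inner y (X y) (e i y))
    (W := e) continuousAt_id (fun i _ => ?_) (fun i _ => he.sectionDiffAt hU hx i) v
  have := he.contMDiffOn_coeff (W := W ∩ U) inter_subset_right (hX.mono inter_subset_left) i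
  exact (this.contMDiffAt ((hW.inter hU).mem_nhds ⟨hxW, hx⟩)).mdifferentiableAt (by simp)

theorem ext_coeff_mdifferentiableAt (he : IsOrthonormalFrameOn g e U) (hU : IsOpen U)
    {x : M} (hx : x ∈ U) (w : TangentSpace (𝓡 m) x) (i : Fin m) :
    MDifferentiableAt (𝓡 m) 𝓘(ℝ, ℝ) (fun y => g.inner y (ext w y) (e i y)) x := by
  have := he.contMDiffOn_coeff (W := (chartAt (EuclideanSpace ℝ (Fin m)) x).source ∩ U)
    inter_subset_right ((isSmoothFieldOn_ext w).mono inter_subset_left) i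
  exact (this.contMDiffAt (((chartAt (EuclideanSpace ℝ (Fin m)) x).open_source.inter hU).mem_nhds
    ⟨mem_chart_source _ _, hx⟩)).mdifferentiableAt (by simp)

theorem leviCivita_ext (he : IsOrthonormalFrameOn g e U) (hU : IsOpen U)
    {x : M} (hx : x ∈ U) (w v : TangentSpace (𝓡 m) x) :
    leviCivita g (ext w) x v = ∑ i, (vecDeriv (fun y => g.inner y (ext w y) (e i y)) x v • e i x
      + g.inner x w (e i x) • leviCivita g (e i) x v) := by
  rw [he.leviCivita_eq_sum hU (chartAt (EuclideanSpace ℝ (Fin m)) x).open_source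
    (isSmoothFieldOn_ext w) hx (mem_chart_source _ _) v]
  simp only [ext_self]

theorem isLinearMap_leviCivita (g : Metric m M) (X : Π x : M, TangentSpace (𝓡 m) x) (x : M) :
    IsLinearMap ℝ (leviCivita g X x) :=
  ⟨leviCivita_add_right g X x, leviCivita_smul_right g X x⟩

/-- The trace of an expression bilinear on the tangent space, with the second argument expanded. -/
theorem metricTrace_eq_sum_inner (g : Metric m M) (x : M) {F : Type*} [AddCommGroup F] [Module ℝ F]
    {ι : Type} [Fintype ι] (w : ι → TangentSpace (𝓡 m) x) (C : ι → TangentSpace (𝓡 m) x →ₗ[ℝ] F)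
    (B : TangentSpace (𝓡 m) x → TangentSpace (𝓡 m) x → F)
    (hB : ∀ u v, B u v = ∑ k, g.inner x v (w k) • C k u) :
    metricTrace g x B = ∑ k, C k (w k) :=
  metricTrace_eq_sum g x w C B hB

/-- Traces of expressions `∇^φ_v (L w) - L (∇_v w)` in an orthonormal frame. -/
theorem metricTrace_inducedConn (he : IsOrthonormalFrameOn g e U) (hU : IsOpen U)
    (h : Metric n N) {φ : M → N} (L : Π x : M, TangentSpace (𝓡 m) x →ₗ[ℝ] TangentSpace (𝓡 n) (φ x))
    {x : M} (hx : x ∈ U) (hφ : ContinuousAt φ x)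
    (hL : ∀ i, SectionDiffAt m φ (fun y => L y (e i y)) x) :
    (metricTrace g x fun v w => inducedConn h φ (fun y => L y (ext w y)) x v
      - L x (leviCivita g (ext w) x v)) =
    ∑ i, (inducedConn h φ (fun y => L y (e i y)) x (e i x) - L x (leviCivita g (e i) x (e i x))) := by
  let C : Fin m → TangentSpace (𝓡 m) x →ₗ[ℝ] TangentSpace (𝓡 n) (φ x) := fun i =>
    inducedConnLin h φ (fun y => L y (e i y)) x - (L x).comp ((isLinearMap_leviCivita g (e i) x).mk' _)
  refine metricTrace_eq_sum_inner g x (fun i => e i x) C _ fun v w => ?_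
  have h1 : ∀ᶠ y in 𝓝 x, L y (ext w y) =
      ∑ i, g.inner y (ext w y) (e i y) • L y (e i y) := by
    filter_upwards [hU.mem_nhds hx] with y hy
    conv_lhs => rw [he.expansion hy (ext w y)]
    simp only [map_sum, map_smul]
  rw [inducedConn_congr h h1, inducedConn_sum h φ Finset.univ
    (a := fun i y => g.inner y (ext w y) (e i y))
    (W := fun i y => L y (e i y)) hφ (fun i _ => ext_coeff_mdifferentiableAt he hU hx w i)
    (fun i _ => hL i), leviCivita_ext he hU hx, map_sum, ← Finset.sum_sub_distrib]
  refine Finset.sum_congr rfl fun i _ => ?_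
  -- The derivatives of the coefficients of `ext w` occur both in `∇^φ_v (L w)` and in `L (∇_v w)`
  -- and cancel. What remains is tensorial in `w`, so the choice of extension does not matter.
  rw [map_add, map_smul, map_smul, add_sub_add_left_eq_sub, ext_self, ← smul_sub]
  rfl

/-- The Laplace-Beltrami operator in an orthonormal frame. -/
theorem laplacian_eq_sum (he : IsOrthonormalFrameOn g e U) (hU : IsOpen U) {u : M → ℝ}
    (hu : ContMDiffOn (𝓡 m) 𝓘(ℝ, ℝ) ∞ u U) {x : M} (hx : x ∈ U) :
    laplacian g u x = ∑ i, (vecDeriv (dirDeriv (e i) u) x (e i x)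
      - vecDeriv u x (leviCivita g (e i) x (e i x))) := by
  let C : Fin m → TangentSpace (𝓡 m) x →ₗ[ℝ] ℝ := fun i =>
    vecDerivLin (dirDeriv (e i) u) x - (vecDerivLin u x).comp ((isLinearMap_leviCivita g (e i) x).mk' _)
  unfold laplacian
  refine metricTrace_eq_sum_inner g x (fun i => e i x) C _ fun v w => ?_
  have h1 : ∀ᶠ y in 𝓝 x, dirDeriv (ext w) u y =
      ∑ i, g.inner y (ext w y) (e i y) * dirDeriv (e i) u y := by
    filter_upwards [hU.mem_nhds hx] with y hy
    have := map_sum (vecDerivLin u y) (fun i => g.inner y (ext w y)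
      (e i y) • e i y) Finset.univ
    rw [← he.expansion hy (ext w y)] at this
    simp only [map_smul] at this
    exact this
  have hd : ∀ i, MDifferentiableAt (𝓡 m) 𝓘(ℝ, ℝ) (dirDeriv (e i) u) x := fun i =>
    ((contMDiffOn_dirDeriv hU (he.smooth i) hu).contMDiffAt (hU.mem_nhds hx)).mdifferentiableAt
      (by simp)
  have hb := fun i => ext_coeff_mdifferentiableAt he hU hx w i
  have h2 := map_sum (vecDerivLin u x) (fun i =>
    (vecDeriv (fun y => g.inner y (ext w y) (e i y)) x v • e i x
      + g.inner x w (e i x) • leviCivita g (e i) x v)) Finset.univ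
  rw [← leviCivita_ext he hU hx] at h2
  have h3 : vecDeriv u x (leviCivita g (ext w) x v) = _ := h2
  rw [vecDeriv_congr h1, vecDeriv_sum (u := fun i y => g.inner y (ext w y) (e i y) * dirDeriv (e i) u y) _
    (fun i _ => (hb i).mul (hd i)), h3,
    ← Finset.sum_sub_distrib]
  refine Finset.sum_congr rfl fun i _ => ?_
  -- The same cancellation as for sections: the derivatives of the coefficients of `ext w` disappear
  -- from the Hessian.
  rw [vecDeriv_mul (hb i) (hd i), map_add, map_smul, map_smul]
  have e1 : vecDerivLin u x (e i x) = dirDeriv (e i) u x := rfl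
  rw [e1, ext_self, smul_eq_mul, smul_eq_mul, add_sub_add_left_eq_sub, ← mul_sub]
  rfl

end OrthonormalFrame

/-! ### Connection form and curvature of a framed surface. -/

section Surface

variable {m : ℕ}
  {M : Type*} [TopologicalSpace M] [ChartedSpace (EuclideanSpace ℝ (Fin m)) M]
  [IsManifold (𝓡 m) ∞ M]
  {N : Type*} [TopologicalSpace N] [ChartedSpace (EuclideanSpace ℝ (Fin 2)) N]
  [IsManifold (𝓡 2) ∞ N]
  {h : Metric 2 N} {ε : Fin 2 → Π y : N, TangentSpace (𝓡 2) y} {V : Set N} {F₁ F₂ : N → ℝ}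

/-- The connection form of a frame on a surface with `[ε₁, ε₂] = F₁ ε₁ + F₂ ε₂`. -/
noncomputable def connForm (h : Metric 2 N) (ε : Fin 2 → Π y : N, TangentSpace (𝓡 2) y) (F₁ F₂ : N → ℝ) (y : N)
    (v : TangentSpace (𝓡 2) y) : ℝ :=
  F₁ y * h.inner y v (ε 0 y) + F₂ y * h.inner y v (ε 1 y)

/-- The Gaussian curvature in terms of the structure functions of a frame. -/
noncomputable def frameCurvature (ε : Fin 2 → Π y : N, TangentSpace (𝓡 2) y) (F₁ F₂ : N → ℝ) (y : N) : ℝ :=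
  dirDeriv (ε 0) F₂ y - dirDeriv (ε 1) F₁ y - (F₁ y ^ 2 + F₂ y ^ 2)

theorem IsOrthonormalFrameOn.inner_pair_zero (hε : IsOrthonormalFrameOn h ε V) {y : N} (hy : y ∈ V)
    (a b : ℝ) : h.inner y (a • ε 0 y + b • ε 1 y) (ε 0 y) = a := by
  rw [map_add, map_smul, map_smul, add_apply, smul_apply, smul_apply,
    hε.orthonormal y hy, hε.orthonormal y hy]
  simp

theorem IsOrthonormalFrameOn.inner_pair_one (hε : IsOrthonormalFrameOn h ε V) {y : N} (hy : y ∈ V)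
    (a b : ℝ) : h.inner y (a • ε 0 y + b • ε 1 y) (ε 1 y) = b := by
  rw [map_add, map_smul, map_smul, add_apply, smul_apply, smul_apply,
    hε.orthonormal y hy, hε.orthonormal y hy]
  simp

theorem IsOrthonormalFrameOn.expansion_pair (hε : IsOrthonormalFrameOn h ε V) {y : N} (hy : y ∈ V)
    (v : TangentSpace (𝓡 2) y) :
    v = h.inner y v (ε 0 y) • ε 0 y + h.inner y v (ε 1 y) • ε 1 y := by
  have := hε.expansion hy v
  rwa [Fin.sum_univ_two] at this

theorem IsOrthonormalFrameOn.pair_eq_zero_iff (hε : IsOrthonormalFrameOn h ε V) {y : N}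
    (hy : y ∈ V) (a b : ℝ) : a • ε 0 y + b • ε 1 y = 0 ↔ a = 0 ∧ b = 0 := by
  refine ⟨fun H => ⟨?_, ?_⟩, fun ⟨ha, hb⟩ => by rw [ha, hb, zero_smul, zero_smul, add_zero]⟩
  · rw [← hε.inner_pair_zero hy a b, H, map_zero, zero_apply]
  · rw [← hε.inner_pair_one hy a b, H, map_zero, zero_apply]

/-- Both sides are linear in `v`, and the bracket gives the values at `ε 0 y` and `ε 1 y`. -/
theorem IsOrthonormalFrameOn.inner_leviCivita_zero_one (hε : IsOrthonormalFrameOn h ε V)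
    (hV : IsOpen V)
    (hbr : ∀ y ∈ V, mlieBracket (𝓡 2) (ε 0) (ε 1) y = F₁ y • ε 0 y + F₂ y • ε 1 y)
    {y : N} (hy : y ∈ V) (v : TangentSpace (𝓡 2) y) :
    h.inner y (leviCivita h (ε 0) y v) (ε 1 y) = -connForm h ε F₁ F₂ y v := by
  have h0 : h.inner y (leviCivita h (ε 0) y (ε 0 y)) (ε 1 y) = -F₁ y := by
    rw [hε.inner_leviCivita_eq_bracket hV hy, hbr y hy, hε.inner_pair_zero hy]
  have h1 : h.inner y (leviCivita h (ε 0) y (ε 1 y)) (ε 1 y) = -F₂ y := by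
    have e1 := hε.inner_leviCivita_add hV hy 0 1 (ε 1 y)
    have e2 := hε.inner_leviCivita_eq_bracket hV hy 1 0
    rw [mlieBracket_swap_apply, map_neg, neg_apply, hbr y hy, hε.inner_pair_one hy] at e2
    rw [h.symm y (ε 0 y)] at e1
    linarith
  conv_lhs => rw [hε.expansion_pair hy v]
  rw [leviCivita_add_right, leviCivita_smul_right, leviCivita_smul_right, map_add, map_smul,
    map_smul, add_apply, smul_apply, smul_apply, h0, h1, connForm, smul_eq_mul, smul_eq_mul]
  ring

theorem IsOrthonormalFrameOn.leviCivita_zero (hε : IsOrthonormalFrameOn h ε V) (hV : IsOpen V)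
    (hbr : ∀ y ∈ V, mlieBracket (𝓡 2) (ε 0) (ε 1) y = F₁ y • ε 0 y + F₂ y • ε 1 y)
    {y : N} (hy : y ∈ V) (v : TangentSpace (𝓡 2) y) :
    leviCivita h (ε 0) y v = -connForm h ε F₁ F₂ y v • ε 1 y := by
  rw [hε.expansion_pair hy (leviCivita h (ε 0) y v), hε.inner_leviCivita_self hV hy,
    hε.inner_leviCivita_zero_one hV hbr hy, zero_smul, zero_add]

theorem IsOrthonormalFrameOn.leviCivita_one (hε : IsOrthonormalFrameOn h ε V) (hV : IsOpen V)
    (hbr : ∀ y ∈ V, mlieBracket (𝓡 2) (ε 0) (ε 1) y = F₁ y • ε 0 y + F₂ y • ε 1 y)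
    {y : N} (hy : y ∈ V) (v : TangentSpace (𝓡 2) y) :
    leviCivita h (ε 1) y v = connForm h ε F₁ F₂ y v • ε 0 y := by
  have e1 := hε.inner_leviCivita_add hV hy 0 1 v
  rw [h.symm y (ε 0 y), hε.inner_leviCivita_zero_one hV hbr hy] at e1
  have e2 : h.inner y (leviCivita h (ε 1) y v) (ε 0 y) = connForm h ε F₁ F₂ y v := by linarith
  rw [hε.expansion_pair hy (leviCivita h (ε 1) y v), hε.inner_leviCivita_self hV hy, e2,
    zero_smul, add_zero]

/-- The connection along `φ` in a frame of the target surface. -/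
theorem IsOrthonormalFrameOn.inducedConn_pair (hε : IsOrthonormalFrameOn h ε V) (hV : IsOpen V)
    (hbr : ∀ y ∈ V, mlieBracket (𝓡 2) (ε 0) (ε 1) y = F₁ y • ε 0 y + F₂ y • ε 1 y)
    {φ : M → N} {x : M} (hφ : MDifferentiableAt (𝓡 m) (𝓡 2) φ x) (hx : φ x ∈ V) {P Q : M → ℝ}
    (hP : MDifferentiableAt (𝓡 m) 𝓘(ℝ, ℝ) P x) (hQ : MDifferentiableAt (𝓡 m) 𝓘(ℝ, ℝ) Q x)
    {W : Π x : M, TangentSpace (𝓡 2) (φ x)}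
    (hW : ∀ᶠ y in 𝓝 x, W y = P y • ε 0 (φ y) + Q y • ε 1 (φ y)) (v : TangentSpace (𝓡 m) x) :
    inducedConn h φ W x v =
      (vecDeriv P x v + connForm h ε F₁ F₂ (φ x) (mfderiv (𝓡 m) (𝓡 2) φ x v) * Q x) • ε 0 (φ x)
      + (vecDeriv Q x v - connForm h ε F₁ F₂ (φ x) (mfderiv (𝓡 m) (𝓡 2) φ x v) * P x)
        • ε 1 (φ x) := by
  have h1 : ∀ᶠ y in 𝓝 x, W y = ∑ i : Fin 2, (![P, Q] i) y • ε i (φ y) := by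
    filter_upwards [hW] with y hy
    rw [hy, Fin.sum_univ_two]
    rfl
  rw [inducedConn_congr h h1, inducedConn_sum h φ Finset.univ (a := ![P, Q])
    (W := fun i y => ε i (φ y)) hφ.continuousAt ?_
    (fun i _ => (hε.sectionDiffAt hV hx i).comp hφ), Fin.sum_univ_two]
  · rw [inducedConn_comp h (hε.sectionDiffAt hV hx 0) hφ,
      inducedConn_comp h (hε.sectionDiffAt hV hx 1) hφ, hε.leviCivita_zero hV hbr hx,
      hε.leviCivita_one hV hbr hx]
    simp only [Matrix.cons_val_zero, Matrix.cons_val_one]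
    module
  · intro i _
    fin_cases i
    exacts [hP, hQ]

theorem IsOrthonormalFrameOn.sectionDiffAt_pair (hε : IsOrthonormalFrameOn h ε V) (hV : IsOpen V)
    {φ : M → N} {x : M} (hφ : MDifferentiableAt (𝓡 m) (𝓡 2) φ x) (hx : φ x ∈ V) {P Q : M → ℝ}
    (hP : MDifferentiableAt (𝓡 m) 𝓘(ℝ, ℝ) P x) (hQ : MDifferentiableAt (𝓡 m) 𝓘(ℝ, ℝ) Q x)
    {W : Π x : M, TangentSpace (𝓡 2) (φ x)}
    (hW : ∀ᶠ y in 𝓝 x, W y = P y • ε 0 (φ y) + Q y • ε 1 (φ y)) : SectionDiffAt m φ W x := by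
  have h1 : ∀ᶠ y in 𝓝 x, W y = ∑ i : Fin 2, (![P, Q] i) y • ε i (φ y) := by
    filter_upwards [hW] with y hy
    rw [hy, Fin.sum_univ_two]
    rfl
  refine SectionDiffAt.congr (SectionDiffAt.sum (s := Finset.univ) (a := ![P, Q])
    (W := fun i y => ε i (φ y)) hφ.continuousAt ?_
    (fun i _ => (hε.sectionDiffAt hV hx i).comp hφ)) h1
  intro i _
  fin_cases i
  exacts [hP, hQ]

/-- The case `φ = id` of `IsOrthonormalFrameOn.inducedConn_pair`. -/
theorem IsOrthonormalFrameOn.leviCivita_pair (hε : IsOrthonormalFrameOn h ε V) (hV : IsOpen V)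
    (hbr : ∀ y ∈ V, mlieBracket (𝓡 2) (ε 0) (ε 1) y = F₁ y • ε 0 y + F₂ y • ε 1 y)
    {y : N} (hy : y ∈ V) {P Q : N → ℝ}
    (hP : MDifferentiableAt (𝓡 2) 𝓘(ℝ, ℝ) P y) (hQ : MDifferentiableAt (𝓡 2) 𝓘(ℝ, ℝ) Q y)
    {W : Π y : N, TangentSpace (𝓡 2) y}
    (hW : ∀ᶠ z in 𝓝 y, W z = P z • ε 0 z + Q z • ε 1 z) (v : TangentSpace (𝓡 2) y) :
    leviCivita h W y v =
      (vecDeriv P y v + connForm h ε F₁ F₂ y v * Q y) • ε 0 y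
      + (vecDeriv Q y v - connForm h ε F₁ F₂ y v * P y) • ε 1 y := by
  have e := hε.inducedConn_pair (φ := fun z : N => z) hV hbr mdifferentiableAt_id hy hP hQ hW v
  have e1 : mfderiv (𝓡 2) (𝓡 2) (fun z : N => z) y v = v :=
    congrArg (fun L : EuclideanSpace ℝ (Fin 2) →L[ℝ] EuclideanSpace ℝ (Fin 2) => L v)
      (mfderiv_id (I := 𝓡 2) (x := y))
  rw [e1] at e
  rw [leviCivita_eq_inducedConn]
  exact e

/-- The curvature operator of a surface in an orthonormal frame. -/
theorem IsOrthonormalFrameOn.curvatureField_eq (hε : IsOrthonormalFrameOn h ε V) (hV : IsOpen V)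
    (hbr : ∀ y ∈ V, mlieBracket (𝓡 2) (ε 0) (ε 1) y = F₁ y • ε 0 y + F₂ y • ε 1 y)
    (hF₁ : ContMDiffOn (𝓡 2) 𝓘(ℝ, ℝ) ∞ F₁ V) (hF₂ : ContMDiffOn (𝓡 2) 𝓘(ℝ, ℝ) ∞ F₂ V)
    {W : Set N} (hW : IsOpen W) (hWV : W ⊆ V) {X Y Z : Π y : N, TangentSpace (𝓡 2) y}
    (hX : IsSmoothFieldOn X W) (hY : IsSmoothFieldOn Y W) (hZ : IsSmoothFieldOn Z W)
    {y : N} (hy : y ∈ W) :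
    curvatureField h X Y Z y =
      (frameCurvature ε F₁ F₂ y * (h.inner y (X y) (ε 0 y) * h.inner y (Y y) (ε 1 y)
        - h.inner y (X y) (ε 1 y) * h.inner y (Y y) (ε 0 y))) •
      (h.inner y (Z y) (ε 1 y) • ε 0 y - h.inner y (Z y) (ε 0 y) • ε 1 y) := by
  set x0 : N → ℝ := fun y => h.inner y (X y) (ε 0 y) with hx0
  set x1 : N → ℝ := fun y => h.inner y (X y) (ε 1 y) with hx1
  set y0 : N → ℝ := fun y => h.inner y (Y y) (ε 0 y) with hy0
  set y1 : N → ℝ := fun y => h.inner y (Y y) (ε 1 y) with hy1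
  set z0 : N → ℝ := fun y => h.inner y (Z y) (ε 0 y) with hz0
  set z1 : N → ℝ := fun y => h.inner y (Z y) (ε 1 y) with hz1
  have sx0 : ContMDiffOn (𝓡 2) 𝓘(ℝ, ℝ) ∞ x0 W := hε.contMDiffOn_coeff hWV hX 0
  have sx1 : ContMDiffOn (𝓡 2) 𝓘(ℝ, ℝ) ∞ x1 W := hε.contMDiffOn_coeff hWV hX 1
  have sy0 : ContMDiffOn (𝓡 2) 𝓘(ℝ, ℝ) ∞ y0 W := hε.contMDiffOn_coeff hWV hY 0
  have sy1 : ContMDiffOn (𝓡 2) 𝓘(ℝ, ℝ) ∞ y1 W := hε.contMDiffOn_coeff hWV hY 1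
  have sz0 : ContMDiffOn (𝓡 2) 𝓘(ℝ, ℝ) ∞ z0 W := hε.contMDiffOn_coeff hWV hZ 0
  have sz1 : ContMDiffOn (𝓡 2) 𝓘(ℝ, ℝ) ∞ z1 W := hε.contMDiffOn_coeff hWV hZ 1
  have hd : ∀ {f : N → ℝ}, ContMDiffOn (𝓡 2) 𝓘(ℝ, ℝ) ∞ f W → ∀ {p}, p ∈ W →
      MDifferentiableAt (𝓡 2) 𝓘(ℝ, ℝ) f p := fun hf p hp =>
    (hf.contMDiffAt (hW.mem_nhds hp)).mdifferentiableAt (by simp)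
  have sF₁ := hF₁.mono hWV
  have sF₂ := hF₂.mono hWV
  have hyV := hWV hy
  have expd : ∀ A : Π y : N, TangentSpace (𝓡 2) y, ∀ p ∈ W, ∀ᶠ z in 𝓝 p,
      A z = h.inner z (A z) (ε 0 z) • ε 0 z + h.inner z (A z) (ε 1 z) • ε 1 z := fun A p hp => by
    filter_upwards [hV.mem_nhds (hWV hp)] with z hz
    exact hε.expansion_pair hz _
  have first : ∀ {A B : Π y : N, TangentSpace (𝓡 2) y} {b0 b1 : N → ℝ},
      (∀ p, b0 p = h.inner p (B p) (ε 0 p)) → (∀ p, b1 p = h.inner p (B p) (ε 1 p)) →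
      ContMDiffOn (𝓡 2) 𝓘(ℝ, ℝ) ∞ b0 W → ContMDiffOn (𝓡 2) 𝓘(ℝ, ℝ) ∞ b1 W →
      ∀ p ∈ W, leviCivita h B p (A p) =
        (dirDeriv A b0 p + connForm h ε F₁ F₂ p (A p) * b1 p) • ε 0 p
        + (dirDeriv A b1 p - connForm h ε F₁ F₂ p (A p) * b0 p) • ε 1 p := by
    intro A B b0 b1 e0 e1 s0 s1 p hp
    refine hε.leviCivita_pair hV hbr (hWV hp) (hd s0 hp) (hd s1 hp) ?_ _
    filter_upwards [expd B p hp] with z hz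
    rw [e0, e1]
    exact hz
  have second : ∀ {A B : Π y : N, TangentSpace (𝓡 2) y}, IsSmoothFieldOn B W →
      ContMDiffOn (𝓡 2) 𝓘(ℝ, ℝ) ∞ (fun p => connForm h ε F₁ F₂ p (B p)) W →
      leviCivita h (fun z => leviCivita h Z z (B z)) y (A y) =
        (vecDeriv (dirDeriv B z0) y (A y)
          + (vecDeriv (fun p => connForm h ε F₁ F₂ p (B p)) y (A y) * z1 y
            + connForm h ε F₁ F₂ y (B y) * vecDeriv z1 y (A y))
          + connForm h ε F₁ F₂ y (A y)
            * (dirDeriv B z1 y - connForm h ε F₁ F₂ y (B y) * z0 y)) • ε 0 y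
        + (vecDeriv (dirDeriv B z1) y (A y)
          - (vecDeriv (fun p => connForm h ε F₁ F₂ p (B p)) y (A y) * z0 y
            + connForm h ε F₁ F₂ y (B y) * vecDeriv z0 y (A y))
          - connForm h ε F₁ F₂ y (A y)
            * (dirDeriv B z0 y + connForm h ε F₁ F₂ y (B y) * z1 y)) • ε 1 y := by
    intro A B hB hω
    have d0 := hd (contMDiffOn_dirDeriv hW hB sz0) hy
    have d1 := hd (contMDiffOn_dirDeriv hW hB sz1) hy
    have dω := hd hω hy
    have m1 := dω.mul (hd sz1 hy)
    have m0 := dω.mul (hd sz0 hy)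
    have key := hε.leviCivita_pair hV hbr hyV (d0.add m1) (d1.sub m0)
      (W := fun z => leviCivita h Z z (B z)) (by
        filter_upwards [hW.mem_nhds hy] with p hp
        exact first (fun _ => rfl) (fun _ => rfl) sz0 sz1 p hp) (A y)
    have v1 := vecDeriv_add d0 m1 (A y)
    have v0 := vecDeriv_sub d1 m0 (A y)
    have w1 := vecDeriv_mul dω (hd sz1 hy) (A y)
    have w0 := vecDeriv_mul dω (hd sz0 hy) (A y)
    refine key.trans ?_
    rw [← w1, ← w0]
    exact congrArg₂ (fun a b : ℝ => (a + connForm h ε F₁ F₂ y (A y)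
            * (dirDeriv B z1 y - connForm h ε F₁ F₂ y (B y) * z0 y)) • ε 0 y +
        (b - connForm h ε F₁ F₂ y (A y)
            * (dirDeriv B z0 y + connForm h ε F₁ F₂ y (B y) * z1 y)) • ε 1 y) v1 v0
  have sω : ∀ {b0 b1 : N → ℝ}, ContMDiffOn (𝓡 2) 𝓘(ℝ, ℝ) ∞ b0 W →
      ContMDiffOn (𝓡 2) 𝓘(ℝ, ℝ) ∞ b1 W →
      ContMDiffOn (𝓡 2) 𝓘(ℝ, ℝ) ∞ (fun p => F₁ p * b0 p + F₂ p * b1 p) W :=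
    fun s0 s1 => (sF₁.mul s0).add (sF₂.mul s1)
  have dω : ∀ {b0 b1 : N → ℝ}, ContMDiffOn (𝓡 2) 𝓘(ℝ, ℝ) ∞ b0 W →
      ContMDiffOn (𝓡 2) 𝓘(ℝ, ℝ) ∞ b1 W → ∀ v : TangentSpace (𝓡 2) y,
      vecDeriv (fun p => F₁ p * b0 p + F₂ p * b1 p) y v =
        vecDeriv F₁ y v * b0 y + F₁ y * vecDeriv b0 y v
          + (vecDeriv F₂ y v * b1 y + F₂ y * vecDeriv b1 y v) := by
    intro b0 b1 s0 s1 v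
    rw [← vecDeriv_mul (hd sF₁ hy) (hd s0 hy), ← vecDeriv_mul (hd sF₂ hy) (hd s1 hy)]
    exact vecDeriv_add ((hd sF₁ hy).mul (hd s0 hy)) ((hd sF₂ hy).mul (hd s1 hy)) v
  -- `ε 0` serves as the nonvanishing auxiliary field in the commutator formula.
  have hne : ε 0 y ≠ 0 := by
    intro h0
    have := hε.orthonormal y hyV 0 0
    rw [h0, map_zero] at this
    simp at this
  have comm := fun {u : N → ℝ} (hu : ContMDiffOn (𝓡 2) 𝓘(ℝ, ℝ) ∞ u W) =>
    vecDeriv_dirDeriv_sub hW hX hY (fun p hp => hε.smooth 0 p (hWV hp) |>.mono hWV) hu hy hne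
  -- Torsion-freeness supplies the frame components of `[X, Y]`, which enter `ω([X, Y])`.
  have lie := leviCivita_sub_leviCivita h (hX.sectionDiffAt hW hy) (hY.sectionDiffAt hW hy)
  rw [first (A := X) (B := Y) (b0 := y0) (b1 := y1) (fun _ => rfl) (fun _ => rfl) sy0 sy1 y hy,
    first (A := Y) (B := X) (b0 := x0) (b1 := x1) (fun _ => rfl) (fun _ => rfl) sx0 sx1 y hy] at lie
  have lie0 : h.inner y (mlieBracket (𝓡 2) X Y y) (ε 0 y) = _ :=
    (congrArg (fun v => h.inner y v (ε 0 y)) lie).symm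
  have lie1 : h.inner y (mlieBracket (𝓡 2) X Y y) (ε 1 y) = _ :=
    (congrArg (fun v => h.inner y v (ε 1 y)) lie).symm
  simp only [map_sub, sub_apply, hε.inner_pair_zero hyV, hε.inner_pair_one hyV] at lie0 lie1
  have third : leviCivita h Z y (mlieBracket (𝓡 2) X Y y) = _ :=
    first (A := fun p => mlieBracket (𝓡 2) X Y p) (b0 := z0) (b1 := z1) (fun _ => rfl) (fun _ => rfl) sz0 sz1 y hy
  have dX : ∀ u : N → ℝ, vecDeriv u y (X y) =
      x0 y * dirDeriv (ε 0) u y + x1 y * dirDeriv (ε 1) u y := fun u => by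
    rw [hε.expansion_pair hyV (X y), vecDeriv_add_right, vecDeriv_smul_right, vecDeriv_smul_right]
    rfl
  have dY : ∀ u : N → ℝ, vecDeriv u y (Y y) =
      y0 y * dirDeriv (ε 0) u y + y1 y * dirDeriv (ε 1) u y := fun u => by
    rw [hε.expansion_pair hyV (Y y), vecDeriv_add_right, vecDeriv_smul_right, vecDeriv_smul_right]
    rfl
  have hωX : ∀ p, connForm h ε F₁ F₂ p (X p) = F₁ p * x0 p + F₂ p * x1 p := fun _ => rfl
  have hωY : ∀ p, connForm h ε F₁ F₂ p (Y p) = F₁ p * y0 p + F₂ p * y1 p := fun _ => rfl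
  have hωL : connForm h ε F₁ F₂ y (mlieBracket (𝓡 2) X Y y) =
      F₁ y * h.inner y (mlieBracket (𝓡 2) X Y y) (ε 0 y)
        + F₂ y * h.inner y (mlieBracket (𝓡 2) X Y y) (ε 1 y) := rfl
  have c0 := comm sz0
  have c1 := comm sz1
  unfold curvatureField
  rw [second (A := X) hY (sω sy0 sy1), second (A := Y) hX (sω sx0 sx1), third]
  have dwY : vecDeriv (fun p => connForm h ε F₁ F₂ p (Y p)) y (X y) = _ := dω sy0 sy1 (X y)
  have dwX : vecDeriv (fun p => connForm h ε F₁ F₂ p (X p)) y (Y y) = _ := dω sx0 sx1 (Y y)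
  -- The structure equation `dω(X, Y) = K dA(X, Y)`, with `dA` the area form.
  have main : vecDeriv (fun p => connForm h ε F₁ F₂ p (Y p)) y (X y)
      - vecDeriv (fun p => connForm h ε F₁ F₂ p (X p)) y (Y y)
      - connForm h ε F₁ F₂ y (mlieBracket (𝓡 2) X Y y)
      = frameCurvature ε F₁ F₂ y * (x0 y * y1 y - x1 y * y0 y) := by
    rw [dwY, dwX, hωL, lie0, lie1, dX F₁, dX F₂, dY F₁, dY F₂, hωX, hωY, frameCurvature]
    simp only [dirDeriv]
    ring
  simp only [dirDeriv] at c0 c1 ⊢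
  rw [← main]
  -- Second derivatives of `z0`, `z1` cancel by the commutator formula. The terms quadratic in `ω`
  -- cancel because rotations of the plane commute; only `dω(X, Y)` survives.
  rw [← c0, ← c1]
  module

theorem IsOrthonormalFrameOn.curvature_eq (hε : IsOrthonormalFrameOn h ε V) (hV : IsOpen V)
    (hbr : ∀ y ∈ V, mlieBracket (𝓡 2) (ε 0) (ε 1) y = F₁ y • ε 0 y + F₂ y • ε 1 y)
    (hF₁ : ContMDiffOn (𝓡 2) 𝓘(ℝ, ℝ) ∞ F₁ V) (hF₂ : ContMDiffOn (𝓡 2) 𝓘(ℝ, ℝ) ∞ F₂ V)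
    {y : N} (hy : y ∈ V) (u v w : TangentSpace (𝓡 2) y) :
    curvature h y u v w =
      (frameCurvature ε F₁ F₂ y * (h.inner y u (ε 0 y) * h.inner y v (ε 1 y)
        - h.inner y u (ε 1 y) * h.inner y v (ε 0 y))) •
      (h.inner y w (ε 1 y) • ε 0 y - h.inner y w (ε 0 y) • ε 1 y) := by
  have hs := fun t : TangentSpace (𝓡 2) y => (isSmoothFieldOn_ext t).mono
    (inter_subset_right (s := V))
  have := hε.curvatureField_eq hV hbr hF₁ hF₂ (hV.inter (chartAt (EuclideanSpace ℝ (Fin 2)) y).open_source)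
    inter_subset_left (hs u) (hs v) (hs w) ⟨hy, mem_chart_source _ _⟩
  simp only [ext_self] at this
  exact this

theorem IsOrthonormalFrameOn.sectionalCurvature_eq (hε : IsOrthonormalFrameOn h ε V)
    (hV : IsOpen V)
    (hbr : ∀ y ∈ V, mlieBracket (𝓡 2) (ε 0) (ε 1) y = F₁ y • ε 0 y + F₂ y • ε 1 y)
    (hF₁ : ContMDiffOn (𝓡 2) 𝓘(ℝ, ℝ) ∞ F₁ V) (hF₂ : ContMDiffOn (𝓡 2) 𝓘(ℝ, ℝ) ∞ F₂ V)
    {y : N} (hy : y ∈ V) :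
    sectionalCurvature h y (ε 0 y) (ε 1 y) = frameCurvature ε F₁ F₂ y := by
  have o := hε.orthonormal y hy
  rw [sectionalCurvature, hε.curvature_eq hV hbr hF₁ hF₂ hy]
  simp only [map_smul, map_sub, smul_apply, sub_apply, o]
  simp

end Surface

/-! ### Traces of bilinear expressions in an orthonormal frame. -/

section Trace

variable {m : ℕ}
  {M : Type*} [TopologicalSpace M] [ChartedSpace (EuclideanSpace ℝ (Fin m)) M]
  [IsManifold (𝓡 m) ∞ M]
  {g : Metric m M} {e : Fin m → Π x : M, TangentSpace (𝓡 m) x} {U : Set M}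

theorem IsOrthonormalFrameOn.metricTrace_eq (he : IsOrthonormalFrameOn g e U) {x : M} (hx : x ∈ U)
    {F : Type*} [AddCommGroup F] [Module ℝ F] {B : TangentSpace (𝓡 m) x → TangentSpace (𝓡 m) x → F}
    (h₁ : ∀ w, IsLinearMap ℝ fun v => B v w) (h₂ : ∀ v, IsLinearMap ℝ (B v)) :
    metricTrace g x B = ∑ i, B (e i x) (e i x) := by
  refine metricTrace_eq_sum_inner g x (fun i => e i x) (fun i => (h₁ (e i x)).mk' _) B
    fun v w => ?_
  have h := map_sum ((h₂ v).mk' _) (fun i => g.inner x w (e i x) • e i x) Finset.univ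
  rw [← he.expansion hx w] at h
  refine h.trans (Finset.sum_congr rfl fun i _ => ?_)
  rw [map_smul]
  rfl

end Trace

/-! ### Linearity of the curvature of a surface in each argument. -/

section CurvatureLinear

variable {N : Type*} [TopologicalSpace N] [ChartedSpace (EuclideanSpace ℝ (Fin 2)) N]
  [IsManifold (𝓡 2) ∞ N]
  {h : Metric 2 N} {ε : Fin 2 → Π y : N, TangentSpace (𝓡 2) y} {V : Set N} {F₁ F₂ : N → ℝ}

/-- `curvature` is defined through extensions, so linearity is read off from the frame formula. It
is what allows `IsOrthonormalFrameOn.metricTrace_eq` to be applied to curvature terms. -/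
theorem IsOrthonormalFrameOn.isLinearMap_curvature_left (hε : IsOrthonormalFrameOn h ε V)
    (hV : IsOpen V)
    (hbr : ∀ y ∈ V, mlieBracket (𝓡 2) (ε 0) (ε 1) y = F₁ y • ε 0 y + F₂ y • ε 1 y)
    (hF₁ : ContMDiffOn (𝓡 2) 𝓘(ℝ, ℝ) ∞ F₁ V) (hF₂ : ContMDiffOn (𝓡 2) 𝓘(ℝ, ℝ) ∞ F₂ V)
    {y : N} (hy : y ∈ V) (v w : TangentSpace (𝓡 2) y) :
    IsLinearMap ℝ fun u => curvature h y u v w := by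
  simp only [hε.curvature_eq hV hbr hF₁ hF₂ hy]
  constructor
  · intro a b
    simp only [map_add, add_apply]
    module
  · intro c a
    simp only [map_smul, smul_apply, smul_eq_mul]
    module

theorem IsOrthonormalFrameOn.isLinearMap_curvature_middle (hε : IsOrthonormalFrameOn h ε V)
    (hV : IsOpen V)
    (hbr : ∀ y ∈ V, mlieBracket (𝓡 2) (ε 0) (ε 1) y = F₁ y • ε 0 y + F₂ y • ε 1 y)
    (hF₁ : ContMDiffOn (𝓡 2) 𝓘(ℝ, ℝ) ∞ F₁ V) (hF₂ : ContMDiffOn (𝓡 2) 𝓘(ℝ, ℝ) ∞ F₂ V)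
    {y : N} (hy : y ∈ V) (u w : TangentSpace (𝓡 2) y) :
    IsLinearMap ℝ fun v => curvature h y u v w := by
  simp only [hε.curvature_eq hV hbr hF₁ hF₂ hy]
  constructor
  · intro a b
    simp only [map_add, add_apply]
    module
  · intro c a
    simp only [map_smul, smul_apply, smul_eq_mul]
    module

theorem IsOrthonormalFrameOn.isLinearMap_curvature_right (hε : IsOrthonormalFrameOn h ε V)
    (hV : IsOpen V)
    (hbr : ∀ y ∈ V, mlieBracket (𝓡 2) (ε 0) (ε 1) y = F₁ y • ε 0 y + F₂ y • ε 1 y)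
    (hF₁ : ContMDiffOn (𝓡 2) 𝓘(ℝ, ℝ) ∞ F₁ V) (hF₂ : ContMDiffOn (𝓡 2) 𝓘(ℝ, ℝ) ∞ F₂ V)
    {y : N} (hy : y ∈ V) (u v : TangentSpace (𝓡 2) y) :
    IsLinearMap ℝ fun w => curvature h y u v w := by
  simp only [hε.curvature_eq hV hbr hF₁ hF₂ hy]
  constructor
  · intro a b
    simp only [map_add, add_apply]
    module
  · intro c a
    simp only [map_smul, smul_apply, smul_eq_mul]
    module

end CurvatureLinear

/-! ### Tension, rough Laplacian and curvature terms in an adapted frame. -/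

section AdaptedFrame

variable
  {M : Type*} [TopologicalSpace M] [ChartedSpace (EuclideanSpace ℝ (Fin 3)) M]
  [IsManifold (𝓡 3) ∞ M]
  {N : Type*} [TopologicalSpace N] [ChartedSpace (EuclideanSpace ℝ (Fin 2)) N]
  [IsManifold (𝓡 2) ∞ N]
  {g : Metric 3 M} {h : Metric 2 N} {φ : M → N} {U : Set M} {V : Set N}
  {e : Fin 3 → Π x : M, TangentSpace (𝓡 3) x} {ε : Fin 2 → Π y : N, TangentSpace (𝓡 2) y}
  {F₁ F₂ : N → ℝ} {f₁ f₂ k₁ k₂ σ : M → ℝ}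

theorem IsOrthonormalFrameOn.expansion_triple (he : IsOrthonormalFrameOn g e U) {x : M}
    (hx : x ∈ U) (v : TangentSpace (𝓡 3) x) :
    v = g.inner x v (e 0 x) • e 0 x + g.inner x v (e 1 x) • e 1 x
      + g.inner x v (e 2 x) • e 2 x := by
  have := he.expansion hx v
  rwa [Fin.sum_univ_three] at this

theorem IsOrthonormalFrameOn.inner_triple (he : IsOrthonormalFrameOn g e U) {x : M} (hx : x ∈ U)
    (a b c : ℝ) (i : Fin 3) :
    g.inner x (a • e 0 x + b • e 1 x + c • e 2 x) (e i x) = ![a, b, c] i := by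
  simp only [map_add, map_smul, add_apply, smul_apply, he.orthonormal x hx]
  fin_cases i <;> simp

theorem IsOrthonormalFrameOn.inner_leviCivita_of_bracket (he : IsOrthonormalFrameOn g e U)
    (hU : IsOpen U) {x : M} (hx : x ∈ U) {i j : Fin 3} {a b c : ℝ}
    (hij : mlieBracket (𝓡 3) (e i) (e j) x = a • e 0 x + b • e 1 x + c • e 2 x) :
    g.inner x (leviCivita g (e i) x (e i x)) (e j x) = -(![a, b, c] i) ∧
      g.inner x (leviCivita g (e j) x (e j x)) (e i x) = ![a, b, c] j := by
  constructor
  · rw [he.inner_leviCivita_eq_bracket hU hx, hij, he.inner_triple hx]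
  · rw [he.inner_leviCivita_eq_bracket hU hx, mlieBracket_swap_apply, hij, map_neg, neg_apply,
      he.inner_triple hx, neg_neg]

variable (he : IsAdaptedFrame g h φ U V e ε)
  (hd : IsIntegrabilityData φ U V e ε F₁ F₂ f₁ f₂ k₁ k₂ σ)
include he hd

/-- Only the diagonal derivatives enter traces. They involve the components of `[eᵢ, eⱼ]` along `eᵢ`
and `eⱼ`, so `σ`, the `e₃`-component of `[e₁, e₂]`, drops out. -/
theorem IsIntegrabilityData.leviCivita_frame {x : M} (hx : x ∈ U) :
    leviCivita g (e 0) x (e 0 x) = -f₁ x • e 1 x ∧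
    leviCivita g (e 1) x (e 1 x) = f₂ x • e 0 x ∧
    leviCivita g (e 2) x (e 2 x) = k₁ x • e 0 x + k₂ x • e 1 x := by
  have o := he.frame_M
  have b01 := o.inner_leviCivita_of_bracket he.isOpen_U hx (i := 0) (j := 1)
    (a := f₁ x) (b := f₂ x) (c := -(2 * σ x)) (by rw [hd.bracket_12 x hx]; module)
  have b02 := o.inner_leviCivita_of_bracket he.isOpen_U hx (i := 0) (j := 2)
    (a := 0) (b := 0) (c := k₁ x) (by rw [hd.bracket_13 x hx]; module)
  have b12 := o.inner_leviCivita_of_bracket he.isOpen_U hx (i := 1) (j := 2)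
    (a := 0) (b := 0) (c := k₂ x) (by rw [hd.bracket_23 x hx]; module)
  simp only [Matrix.cons_val] at b01 b02 b12
  refine ⟨?_, ?_, ?_⟩
  · rw [o.expansion_triple hx (leviCivita g (e 0) x (e 0 x)),
      o.inner_leviCivita_self he.isOpen_U hx, b01.1, b02.1]
    module
  · rw [o.expansion_triple hx (leviCivita g (e 1) x (e 1 x)),
      o.inner_leviCivita_self he.isOpen_U hx, b01.2, b12.1]
    module
  · rw [o.expansion_triple hx (leviCivita g (e 2) x (e 2 x)),
      o.inner_leviCivita_self he.isOpen_U hx, b02.2, b12.2]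
    module

theorem IsIntegrabilityData.laplacian_eq {u : M → ℝ} (hu : ContMDiffOn (𝓡 3) 𝓘(ℝ, ℝ) ∞ u U)
    {x : M} (hx : x ∈ U) :
    laplacian g u x = dirDeriv (e 0) (dirDeriv (e 0) u) x + dirDeriv (e 1) (dirDeriv (e 1) u) x
      + dirDeriv (e 2) (dirDeriv (e 2) u) x - (f₂ x + k₁ x) * dirDeriv (e 0) u x
      - (k₂ x - f₁ x) * dirDeriv (e 1) u x := by
  obtain ⟨h0, h1, h2⟩ := hd.leviCivita_frame he hx
  rw [laplacian_eq_sum he.frame_M he.isOpen_U hu hx, Fin.sum_univ_three, h0, h1, h2,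
    vecDeriv_add_right, vecDeriv_smul_right, vecDeriv_smul_right, vecDeriv_smul_right,
    vecDeriv_smul_right]
  simp only [dirDeriv]
  ring

theorem IsIntegrabilityData.connForm_frame {x : M} (hx : x ∈ U) :
    connForm h ε F₁ F₂ (φ x) (mfderiv (𝓡 3) (𝓡 2) φ x (e 0 x)) = f₁ x ∧
    connForm h ε F₁ F₂ (φ x) (mfderiv (𝓡 3) (𝓡 2) φ x (e 1 x)) = f₂ x ∧
    connForm h ε F₁ F₂ (φ x) (mfderiv (𝓡 3) (𝓡 2) φ x (e 2 x)) = 0 := by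
  have o := he.frame_N.orthonormal (φ x) (he.mapsTo hx)
  rw [he.lift_fst x hx, he.lift_snd x hx, he.vertical x hx, hd.f₁_eq x hx, hd.f₂_eq x hx]
  simp [connForm, o]

theorem IsIntegrabilityData.contMDiffOn_f (hφ : ContMDiff (𝓡 3) (𝓡 2) ∞ φ) :
    ContMDiffOn (𝓡 3) 𝓘(ℝ, ℝ) ∞ f₁ U ∧ ContMDiffOn (𝓡 3) 𝓘(ℝ, ℝ) ∞ f₂ U :=
  ⟨(hd.smooth_F₁.comp hφ.contMDiffOn he.mapsTo).congr hd.f₁_eq,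
    (hd.smooth_F₂.comp hφ.contMDiffOn he.mapsTo).congr hd.f₂_eq⟩

/-- The tension field in an adapted frame. -/
theorem IsIntegrabilityData.tension_eq (hφ : ContMDiff (𝓡 3) (𝓡 2) ∞ φ) {x : M} (hx : x ∈ U) :
    tension g h φ x = (-k₁ x) • ε 0 (φ x) + (-k₂ x) • ε 1 (φ x) := by
  have hφx : MDifferentiableAt (𝓡 3) (𝓡 2) φ x := (hφ x).mdifferentiableAt (by simp)
  have hy := he.mapsTo hx
  have hc : ∀ a : ℝ, MDifferentiableAt (𝓡 3) 𝓘(ℝ, ℝ) (fun _ : M => a) x := fun a =>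
    mdifferentiableAt_const
  have hU := he.isOpen_U.mem_nhds hx
  have W0 : ∀ᶠ y in 𝓝 x, mfderivLin φ y (e 0 y) =
      (fun _ => (1 : ℝ)) y • ε 0 (φ y) + (fun _ => (0 : ℝ)) y • ε 1 (φ y) := by
    filter_upwards [hU] with y hy
    rw [one_smul, zero_smul, add_zero]
    exact he.lift_fst y hy
  have W1 : ∀ᶠ y in 𝓝 x, mfderivLin φ y (e 1 y) =
      (fun _ => (0 : ℝ)) y • ε 0 (φ y) + (fun _ => (1 : ℝ)) y • ε 1 (φ y) := by
    filter_upwards [hU] with y hy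
    rw [one_smul, zero_smul, zero_add]
    exact he.lift_snd y hy
  have W2 : ∀ᶠ y in 𝓝 x, mfderivLin φ y (e 2 y) =
      (fun _ => (0 : ℝ)) y • ε 0 (φ y) + (fun _ => (0 : ℝ)) y • ε 1 (φ y) := by
    filter_upwards [hU] with y hy
    rw [zero_smul, zero_smul, zero_add]
    exact he.vertical y hy
  have key := metricTrace_inducedConn he.frame_M he.isOpen_U h (mfderivLin φ) hx hφx.continuousAt
    (fun i => by
      fin_cases i
      · exact he.frame_N.sectionDiffAt_pair he.isOpen_V hφx hy (hc _) (hc _) W0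
      · exact he.frame_N.sectionDiffAt_pair he.isOpen_V hφx hy (hc _) (hc _) W1
      · exact he.frame_N.sectionDiffAt_pair he.isOpen_V hφx hy (hc _) (hc _) W2)
  refine Eq.trans ?_ (key.trans ?_)
  · rfl
  obtain ⟨h0, h1, h2⟩ := hd.leviCivita_frame he hx
  obtain ⟨w0, w1, w2⟩ := hd.connForm_frame he hx
  have l0 : mfderivLin φ x (e 0 x) = ε 0 (φ x) := he.lift_fst x hx
  have l1 : mfderivLin φ x (e 1 x) = ε 1 (φ x) := he.lift_snd x hx
  rw [Fin.sum_univ_three,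
    he.frame_N.inducedConn_pair he.isOpen_V hd.bracket_N hφx hy (hc _) (hc _) W0,
    he.frame_N.inducedConn_pair he.isOpen_V hd.bracket_N hφx hy (hc _) (hc _) W1,
    he.frame_N.inducedConn_pair he.isOpen_V hd.bracket_N hφx hy (hc _) (hc _) W2,
    w0, w1, w2, h0, h1, h2, map_add, map_smul, map_smul, map_smul, map_smul, l0, l1]
  -- For `e₁` and `e₂` the terms `∇^φ_{eᵢ} dφ(eᵢ)` and `dφ(∇_{eᵢ} eᵢ)` are equal; only `-dφ(∇_{e₃}
  -- e₃)` remains.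
  simp only [vecDeriv_const]
  module

/-- The rough Laplacian of a section along the submersion in an adapted frame. -/
theorem IsIntegrabilityData.roughLaplacian_eq (hφ : ContMDiff (𝓡 3) (𝓡 2) ∞ φ) {P Q : M → ℝ}
    (hP : ContMDiffOn (𝓡 3) 𝓘(ℝ, ℝ) ∞ P U) (hQ : ContMDiffOn (𝓡 3) 𝓘(ℝ, ℝ) ∞ Q U)
    {W : Π x : M, TangentSpace (𝓡 2) (φ x)}
    (hW : ∀ x ∈ U, W x = P x • ε 0 (φ x) + Q x • ε 1 (φ x)) {x : M} (hx : x ∈ U) :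
    roughLaplacian g h φ W x =
      (laplacian g P x + f₁ x * dirDeriv (e 0) Q x + dirDeriv (e 0) (Q * f₁) x
        + f₂ x * dirDeriv (e 1) Q x + dirDeriv (e 1) (Q * f₂) x
        - (k₁ x * f₁ x + k₂ x * f₂ x) * Q x - (f₁ x ^ 2 + f₂ x ^ 2) * P x) • ε 0 (φ x)
      + (laplacian g Q x - f₁ x * dirDeriv (e 0) P x - dirDeriv (e 0) (P * f₁) x
        - f₂ x * dirDeriv (e 1) P x - dirDeriv (e 1) (P * f₂) x
        + (k₁ x * f₁ x + k₂ x * f₂ x) * P x - (f₁ x ^ 2 + f₂ x ^ 2) * Q x) • ε 1 (φ x) := by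
  obtain ⟨hf₁, hf₂⟩ := hd.contMDiffOn_f he hφ
  have hφm : ∀ y, MDifferentiableAt (𝓡 3) (𝓡 2) φ y := fun y => (hφ y).mdifferentiableAt (by simp)
  have hdiff : ∀ {u : M → ℝ}, ContMDiffOn (𝓡 3) 𝓘(ℝ, ℝ) ∞ u U → ∀ {y}, y ∈ U →
      MDifferentiableAt (𝓡 3) 𝓘(ℝ, ℝ) u y := fun hu y hy =>
    (hu.contMDiffAt (he.isOpen_U.mem_nhds hy)).mdifferentiableAt (by simp)
  have hU : ∀ y ∈ U, ∀ᶠ z in 𝓝 y, z ∈ U := fun y hy => he.isOpen_U.mem_nhds hy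
  -- `a i = ω(eᵢ)`, so that the three frame directions are treated by one formula.
  obtain ⟨a, ha, hω⟩ : ∃ a : Fin 3 → M → ℝ, a = ![f₁, f₂, fun _ => 0] ∧ ∀ i, ∀ y ∈ U,
      connForm h ε F₁ F₂ (φ y) (mfderiv (𝓡 3) (𝓡 2) φ y (e i y)) = a i y := by
    refine ⟨_, rfl, fun i y hy => ?_⟩
    obtain ⟨w0, w1, w2⟩ := hd.connForm_frame he hy
    fin_cases i
    exacts [w0, w1, w2]
  have sa : ∀ i, ContMDiffOn (𝓡 3) 𝓘(ℝ, ℝ) ∞ (a i) U := fun i => by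
    rw [ha]
    fin_cases i
    exacts [hf₁, hf₂, contMDiffOn_const]
  have hL : ∀ i, ∀ y ∈ U, inducedConnLin h φ W y (e i y) =
      (dirDeriv (e i) P y + a i y * Q y) • ε 0 (φ y)
        + (dirDeriv (e i) Q y - a i y * P y) • ε 1 (φ y) := fun i y hy => by
    have := he.frame_N.inducedConn_pair he.isOpen_V hd.bracket_N (hφm y) (he.mapsTo hy)
      (hdiff hP hy) (hdiff hQ hy) ((hU y hy).mono hW) (e i y)
    rw [hω i y hy] at this
    exact this
  have dP := fun i => hdiff (contMDiffOn_dirDeriv he.isOpen_U (he.frame_M.smooth i) hP) hx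
  have dQ := fun i => hdiff (contMDiffOn_dirDeriv he.isOpen_U (he.frame_M.smooth i) hQ) hx
  have daP := fun i => hdiff ((sa i).mul hP) hx
  have daQ := fun i => hdiff ((sa i).mul hQ) hx
  -- The rough Laplacian is the trace expression with `L = ∇^φ W`, as the tension field is the one
  -- with `L = dφ`.
  have key := metricTrace_inducedConn he.frame_M he.isOpen_U h (inducedConnLin h φ W) hx
    (hφm x).continuousAt (fun i => he.frame_N.sectionDiffAt_pair he.isOpen_V (hφm x)
      (he.mapsTo hx) ((dP i).add (daQ i)) ((dQ i).sub (daP i)) ((hU x hx).mono (hL i)))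
  refine Eq.trans ?_ (key.trans ?_)
  · rfl
  have second : ∀ i, inducedConn h φ (fun y => inducedConnLin h φ W y (e i y)) x (e i x) =
      (dirDeriv (e i) (dirDeriv (e i) P) x + dirDeriv (e i) (Q * a i) x
        + a i x * (dirDeriv (e i) Q x - a i x * P x)) • ε 0 (φ x)
      + (dirDeriv (e i) (dirDeriv (e i) Q) x - dirDeriv (e i) (P * a i) x
        - a i x * (dirDeriv (e i) P x + a i x * Q x)) • ε 1 (φ x) := fun i => by
    have h1 := he.frame_N.inducedConn_pair he.isOpen_V hd.bracket_N (hφm x)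
      (he.mapsTo hx) ((dP i).add (daQ i)) ((dQ i).sub (daP i)) ((hU x hx).mono (hL i)) (e i x)
    rw [hω i x hx] at h1
    have v1 := vecDeriv_add (dP i) (daQ i) (e i x)
    have v2 := vecDeriv_sub (dQ i) (daP i) (e i x)
    rw [mul_comm Q, mul_comm P]
    refine h1.trans ?_
    exact congrArg₂ (fun b c : ℝ => (b + a i x * (dirDeriv (e i) Q x - a i x * P x)) • ε 0 (φ x)
      + (c - a i x * (dirDeriv (e i) P x + a i x * Q x)) • ε 1 (φ x)) v1 v2
  obtain ⟨h0, h1, h2⟩ := hd.leviCivita_frame he hx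
  have z : ∀ R : M → ℝ, dirDeriv (e 2) (R * fun _ => 0) x = 0 := fun R => by
    have : (R * fun _ => (0 : ℝ)) = fun _ => 0 := by
      ext y
      simp
    rw [this]
    exact vecDeriv_const 0 x _
  rw [Fin.sum_univ_three, second, second, second, h0, h1, h2, map_add, map_smul, map_smul,
    map_smul, map_smul, hL 0 x hx, hL 1 x hx, hd.laplacian_eq he hP hx, hd.laplacian_eq he hQ hx,
    ha]
  -- The first-order correction has `ω(∑ ∇_{eᵢ} eᵢ) = f₁ (f₂ + k₁) + f₂ (k₂ - f₁) = k₁ f₁ + k₂ f₂`.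
  simp only [Matrix.cons_val, z]
  module

/-- The Jacobi operator of a section along the submersion in an adapted frame. -/
theorem IsIntegrabilityData.jacobi_eq {P Q : M → ℝ}
    {W : Π x : M, TangentSpace (𝓡 2) (φ x)} {x : M} (hx : x ∈ U)
    (hW : W x = P x • ε 0 (φ x) + Q x • ε 1 (φ x)) :
    jacobi g h φ W x = roughLaplacian g h φ W x -
      ((frameCurvature ε F₁ F₂ (φ x) * P x) • ε 0 (φ x)
        + (frameCurvature ε F₁ F₂ (φ x) * Q x) • ε 1 (φ x)) := by
  have hy := he.mapsTo hx
  have o := he.frame_N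
  have hR := o.isLinearMap_curvature_right he.isOpen_V hd.bracket_N hd.smooth_F₁ hd.smooth_F₂ hy
  have hMd := o.isLinearMap_curvature_middle he.isOpen_V hd.bracket_N hd.smooth_F₁ hd.smooth_F₂ hy
  have key := he.frame_M.metricTrace_eq hx
    (B := fun v w => curvature h (φ x) (W x) (mfderiv (𝓡 3) (𝓡 2) φ x v)
      (mfderiv (𝓡 3) (𝓡 2) φ x w))
    (fun w => ((hMd (W x) (mfderiv (𝓡 3) (𝓡 2) φ x w)).mk' _ ∘ₗ mfderivLin φ x).isLinear)
    (fun v => ((hR (W x) (mfderiv (𝓡 3) (𝓡 2) φ x v)).mk' _ ∘ₗ mfderivLin φ x).isLinear)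
  unfold jacobi
  rw [key, Fin.sum_univ_three, he.lift_fst x hx, he.lift_snd x hx, he.vertical x hx]
  simp only [o.curvature_eq he.isOpen_V hd.bracket_N hd.smooth_F₁ hd.smooth_F₂ hy, hW,
    o.inner_pair_zero hy, o.inner_pair_one hy, o.orthonormal _ hy, map_zero, zero_apply]
  simp only [Fin.isValue, if_true, reduceIte, one_ne_zero, zero_ne_one]
  -- `R(W, ε₁)ε₁` is the `ε₂`-part of `K W` and `R(W, ε₂)ε₂` its `ε₁`-part; the vertical direction
  -- contributes nothing.
  congr 1
  module

/-- As `W` is parallel to `ε₁` and the curvature is skew, only the `ε₂`-component `-ω(v) P` of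
`∇^φ_v W` matters. Pairing it with `W` produces `P² ω(eᵢ)`. -/
theorem IsIntegrabilityData.metricTrace_curvature_eq (hφ : ContMDiff (𝓡 3) (𝓡 2) ∞ φ) {P : M → ℝ}
    (hP : ContMDiffOn (𝓡 3) 𝓘(ℝ, ℝ) ∞ P U) {W : Π x : M, TangentSpace (𝓡 2) (φ x)}
    (hW : ∀ x ∈ U, W x = P x • ε 0 (φ x)) {x : M} (hx : x ∈ U) :
    (metricTrace g x fun v w => curvature h (φ x) (inducedConn h φ W x v) (W x)
      (mfderiv (𝓡 3) (𝓡 2) φ x w)) =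
    (frameCurvature ε F₁ F₂ (φ x) * (P x ^ 2 * f₂ x)) • ε 0 (φ x)
      - (frameCurvature ε F₁ F₂ (φ x) * (P x ^ 2 * f₁ x)) • ε 1 (φ x) := by
  have hy := he.mapsTo hx
  have o := he.frame_N
  have hφx : MDifferentiableAt (𝓡 3) (𝓡 2) φ x := (hφ x).mdifferentiableAt (by simp)
  have hR := o.isLinearMap_curvature_right he.isOpen_V hd.bracket_N hd.smooth_F₁ hd.smooth_F₂ hy
  have hLt := o.isLinearMap_curvature_left he.isOpen_V hd.bracket_N hd.smooth_F₁ hd.smooth_F₂ hy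
  have hW' : ∀ y ∈ U, W y = P y • ε 0 (φ y) + (fun _ => (0 : ℝ)) y • ε 1 (φ y) := fun y hy => by
    rw [hW y hy, zero_smul, add_zero]
  have hWe : ∀ᶠ y in 𝓝 x, W y = P y • ε 0 (φ y) + (fun _ => (0 : ℝ)) y • ε 1 (φ y) := by
    filter_upwards [he.isOpen_U.mem_nhds hx] with y hy
    exact hW' y hy
  have conn := o.inducedConn_pair he.isOpen_V hd.bracket_N hφx hy
    ((hP.contMDiffAt (he.isOpen_U.mem_nhds hx)).mdifferentiableAt (by simp))
    mdifferentiableAt_const hWe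
  obtain ⟨w0, w1, w2⟩ := hd.connForm_frame he hx
  have key := he.frame_M.metricTrace_eq hx
    (B := fun v w => curvature h (φ x) (inducedConn h φ W x v) (W x)
      (mfderiv (𝓡 3) (𝓡 2) φ x w))
    (fun w => ((hLt (W x) (mfderiv (𝓡 3) (𝓡 2) φ x w)).mk' _ ∘ₗ inducedConnLin h φ W x).isLinear)
    (fun v => ((hR (inducedConn h φ W x v) (W x)).mk' _ ∘ₗ mfderivLin φ x).isLinear)
  rw [key, Fin.sum_univ_three, conn, conn, conn, w0, w1, w2, he.lift_fst x hx, he.lift_snd x hx,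
    he.vertical x hx, hW' x hx]
  simp only [o.curvature_eq he.isOpen_V hd.bracket_N hd.smooth_F₁ hd.smooth_F₂ hy,
    o.inner_pair_zero hy, o.inner_pair_one hy, o.orthonormal _ hy, map_zero, zero_apply]
  simp only [Fin.isValue, if_true, reduceIte, one_ne_zero, zero_ne_one]
  simp only [vecDeriv_const]
  module

end AdaptedFrame

/-! ### The tritension field when `k₂ = 0`. -/

section Tritension

variable
  {M : Type*} [TopologicalSpace M] [ChartedSpace (EuclideanSpace ℝ (Fin 3)) M]
  [IsManifold (𝓡 3) ∞ M]
  {N : Type*} [TopologicalSpace N] [ChartedSpace (EuclideanSpace ℝ (Fin 2)) N]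
  [IsManifold (𝓡 2) ∞ N]
  {g : Metric 3 M} {h : Metric 2 N} {φ : M → N} {U : Set M} {V : Set N}
  {e : Fin 3 → Π x : M, TangentSpace (𝓡 3) x} {ε : Fin 2 → Π y : N, TangentSpace (𝓡 2) y}
  {F₁ F₂ : N → ℝ} {f₁ f₂ k₁ k₂ σ : M → ℝ}

theorem dirDeriv_neg (X : Π x : M, TangentSpace (𝓡 3) x) (u : M → ℝ) :
    dirDeriv X (fun y => -u y) = fun y => -dirDeriv X u y :=
  funext fun y => vecDeriv_neg u y (X y)

theorem dirDeriv_zero (X : Π x : M, TangentSpace (𝓡 3) x) :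
    dirDeriv X (fun _ => 0) = fun _ => 0 :=
  funext fun y => vecDeriv_const 0 y (X y)

variable (he : IsAdaptedFrame g h φ U V e ε)
  (hd : IsIntegrabilityData φ U V e ε F₁ F₂ f₁ f₂ k₁ k₂ σ)
include he hd

theorem IsIntegrabilityData.contMDiffOn_laplacian (hφ : ContMDiff (𝓡 3) (𝓡 2) ∞ φ) {u : M → ℝ}
    (hu : ContMDiffOn (𝓡 3) 𝓘(ℝ, ℝ) ∞ u U) :
    ContMDiffOn (𝓡 3) 𝓘(ℝ, ℝ) ∞ (laplacian g u) U := by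
  obtain ⟨hf₁, hf₂⟩ := hd.contMDiffOn_f he hφ
  have D : ∀ i {w : M → ℝ}, ContMDiffOn (𝓡 3) 𝓘(ℝ, ℝ) ∞ w U →
      ContMDiffOn (𝓡 3) 𝓘(ℝ, ℝ) ∞ (dirDeriv (e i) w) U := fun i _ hw =>
    contMDiffOn_dirDeriv he.isOpen_U (he.frame_M.smooth i) hw
  refine ContMDiffOn.congr (((((D 0 (D 0 hu)).add (D 1 (D 1 hu))).add (D 2 (D 2 hu))).sub
    ((hf₂.add hd.smooth_k₁).mul (D 0 hu))).sub ((hd.smooth_k₂.sub hf₁).mul (D 1 hu)))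
    fun x hx => hd.laplacian_eq he hu hx

/-- The rough Laplacian of the tension field when `k₂ = 0`. -/
theorem IsIntegrabilityData.roughLaplacian_tension_eq (hφ : ContMDiff (𝓡 3) (𝓡 2) ∞ φ)
    (hk₂ : ∀ x ∈ U, k₂ x = 0) {x : M} (hx : x ∈ U) :
    roughLaplacian g h φ (tension g h φ) x =
      (-laplacian g k₁ x + k₁ x * f₁ x ^ 2 + k₁ x * f₂ x ^ 2) • ε 0 (φ x)
      + (f₁ x * dirDeriv (e 0) k₁ x + dirDeriv (e 0) (k₁ * f₁) x + f₂ x * dirDeriv (e 1) k₁ x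
        + dirDeriv (e 1) (k₁ * f₂) x - f₁ x * k₁ x ^ 2) • ε 1 (φ x) := by
  rw [hd.roughLaplacian_eq he hφ (P := fun y => -k₁ y) (Q := fun _ => 0) hd.smooth_k₁.neg
    contMDiffOn_const (fun y hy => by rw [hd.tension_eq he hφ hy, hk₂ y hy, neg_zero]) hx,
    hd.laplacian_eq he hd.smooth_k₁.neg hx, hd.laplacian_eq he contMDiffOn_const hx,
    hd.laplacian_eq he hd.smooth_k₁ hx, hk₂ x hx]
  have z : ∀ u : M → ℝ, ((fun _ => 0) * u : M → ℝ) = fun _ => 0 := fun u => by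
    ext y
    simp
  have n : ∀ u : M → ℝ, ((fun y => -k₁ y) * u : M → ℝ) = fun y => -(k₁ * u) y := fun u => by
    ext y
    simp
  simp only [z, n, dirDeriv_neg, dirDeriv_zero]
  module

/-- The tritension field when `k₂ = 0`. -/
theorem IsIntegrabilityData.tritension_eq (hφ : ContMDiff (𝓡 3) (𝓡 2) ∞ φ)
    (hk₂ : ∀ x ∈ U, k₂ x = 0) {A B : M → ℝ}
    (hA : ContMDiffOn (𝓡 3) 𝓘(ℝ, ℝ) ∞ A U) (hB : ContMDiffOn (𝓡 3) 𝓘(ℝ, ℝ) ∞ B U)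
    (hAB : ∀ x ∈ U, roughLaplacian g h φ (tension g h φ) x = A x • ε 0 (φ x) + B x • ε 1 (φ x))
    {x : M} (hx : x ∈ U) :
    tritension g h φ x =
      (laplacian g A x + f₁ x * dirDeriv (e 0) B x + dirDeriv (e 0) (B * f₁) x
        + f₂ x * dirDeriv (e 1) B x + dirDeriv (e 1) (B * f₂) x - f₁ x * k₁ x * B x
        - A x * (frameCurvature ε F₁ F₂ (φ x) + f₁ x ^ 2 + f₂ x ^ 2)
        - frameCurvature ε F₁ F₂ (φ x) * (k₁ x ^ 2 * f₂ x)) • ε 0 (φ x)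
      + (laplacian g B x - f₁ x * dirDeriv (e 0) A x - dirDeriv (e 0) (A * f₁) x
        - f₂ x * dirDeriv (e 1) A x - dirDeriv (e 1) (A * f₂) x + f₁ x * k₁ x * A x
        - B x * (frameCurvature ε F₁ F₂ (φ x) + f₁ x ^ 2 + f₂ x ^ 2)
        + frameCurvature ε F₁ F₂ (φ x) * (k₁ x ^ 2 * f₁ x)) • ε 1 (φ x) := by
  -- The curvature trace is used with `P = -k₁`, whose square is `k₁²`.
  have hτ : ∀ y ∈ U, tension g h φ y = (fun y => -k₁ y) y • ε 0 (φ y) := fun y hy => by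
    rw [hd.tension_eq he hφ hy, hk₂ y hy, neg_zero, zero_smul, add_zero]
  unfold tritension
  rw [hd.jacobi_eq he hx (hAB x hx), hd.roughLaplacian_eq he hφ hA hB hAB hx,
    hd.metricTrace_curvature_eq he hφ hd.smooth_k₁.neg hτ hx, hk₂ x hx]
  module

end Tritension

end TriharmonicSubmersion

theorem corollary3p2
    {M : Type*} [TopologicalSpace M] [ChartedSpace (EuclideanSpace ℝ (Fin 3)) M]
    [IsManifold (𝓡 3) ∞ M]
    {N : Type*} [TopologicalSpace N] [ChartedSpace (EuclideanSpace ℝ (Fin 2)) N]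
    [IsManifold (𝓡 2) ∞ N]
    (g : TriharmonicSubmersion.Metric 3 M) (h : TriharmonicSubmersion.Metric 2 N)
    (c : ℝ) (hc : TriharmonicSubmersion.HasConstantCurvature g c)
    (φ : M → N) (hφ : TriharmonicSubmersion.IsRiemannianSubmersion g h φ)
    (U : Set M) (V : Set N)
    (e : Fin 3 → Π x : M, TangentSpace (𝓡 3) x)
    (ε : Fin 2 → Π y : N, TangentSpace (𝓡 2) y)
    (he : TriharmonicSubmersion.IsAdaptedFrame g h φ U V e ε)
    (F₁ F₂ : N → ℝ) (f₁ f₂ k₁ k₂ σ : M → ℝ)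
    (hdata : TriharmonicSubmersion.IsIntegrabilityData φ U V e ε F₁ F₂ f₁ f₂ k₁ k₂ σ)
    (hk₂ : ∀ x ∈ U, k₂ x = 0)
    (A B K : M → ℝ)
    (hA : A = fun x => -TriharmonicSubmersion.laplacian g k₁ x
      + k₁ x * f₁ x ^ 2 + k₁ x * f₂ x ^ 2)
    (hB : B = fun x =>
      f₁ x * TriharmonicSubmersion.dirDeriv (e 0) k₁ x
      + TriharmonicSubmersion.dirDeriv (e 0) (k₁ * f₁) x
      + f₂ x * TriharmonicSubmersion.dirDeriv (e 1) k₁ x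
      + TriharmonicSubmersion.dirDeriv (e 1) (k₁ * f₂) x
      - f₁ x * k₁ x ^ 2)
    (hK : K = fun x => TriharmonicSubmersion.sectionalCurvature h (φ x) (ε 0 (φ x)) (ε 1 (φ x))) :
    TriharmonicSubmersion.IsTriharmonicOn g h φ U ↔
      ∀ x ∈ U,
        (TriharmonicSubmersion.laplacian g A x
          + f₁ x * TriharmonicSubmersion.dirDeriv (e 0) B x
          + TriharmonicSubmersion.dirDeriv (e 0) (B * f₁) x
          + f₂ x * TriharmonicSubmersion.dirDeriv (e 1) B x
          + TriharmonicSubmersion.dirDeriv (e 1) (B * f₂) x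
          - f₁ x * k₁ x * B x
          - A x * (K x + f₁ x ^ 2 + f₂ x ^ 2)
          - K x * (k₁ x ^ 2 * f₂ x) = 0) ∧
        (TriharmonicSubmersion.laplacian g B x
          - f₁ x * TriharmonicSubmersion.dirDeriv (e 0) A x
          - TriharmonicSubmersion.dirDeriv (e 0) (A * f₁) x
          - f₂ x * TriharmonicSubmersion.dirDeriv (e 1) A x
          - TriharmonicSubmersion.dirDeriv (e 1) (A * f₂) x
          + f₁ x * k₁ x * A x
          - B x * (K x + f₁ x ^ 2 + f₂ x ^ 2)
          + K x * (k₁ x ^ 2 * f₁ x) = 0) := by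
  have hs := hφ.contMDiff
  have hD : ∀ i {w : M → ℝ}, ContMDiffOn (𝓡 3) 𝓘(ℝ, ℝ) ∞ w U →
      ContMDiffOn (𝓡 3) 𝓘(ℝ, ℝ) ∞ (TriharmonicSubmersion.dirDeriv (e i) w) U := fun i _ hw =>
    TriharmonicSubmersion.contMDiffOn_dirDeriv he.isOpen_U (he.frame_M.smooth i) hw
  obtain ⟨hf₁, hf₂⟩ := hdata.contMDiffOn_f he hs
  have hk₁ := hdata.smooth_k₁
  -- Smoothness of `A'` and `B'` is needed because the rough Laplacian formula is applied a second
  -- time, to `A' ε₁ + B' ε₂`.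
  have hAs : ContMDiffOn (𝓡 3) 𝓘(ℝ, ℝ) ∞ A U := by
    rw [hA]
    exact ((hdata.contMDiffOn_laplacian he hs hk₁).neg.add (hk₁.mul (hf₁.pow 2))).add
      (hk₁.mul (hf₂.pow 2))
  have hBs : ContMDiffOn (𝓡 3) 𝓘(ℝ, ℝ) ∞ B U := by
    rw [hB]
    exact ((((hf₁.mul (hD 0 hk₁)).add (hD 0 (hk₁.mul hf₁))).add (hf₂.mul (hD 1 hk₁))).add
      (hD 1 (hk₁.mul hf₂))).sub (hf₁.mul (hk₁.pow 2))
  have hAB : ∀ x ∈ U, TriharmonicSubmersion.roughLaplacian g h φ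
      (TriharmonicSubmersion.tension g h φ) x = A x • ε 0 (φ x) + B x • ε 1 (φ x) := fun x hx => by
    rw [hdata.roughLaplacian_tension_eq he hs hk₂ hx, hA, hB]
  have hKx : ∀ x ∈ U, K x = TriharmonicSubmersion.frameCurvature ε F₁ F₂ (φ x) := fun x hx => by
    rw [hK]
    exact he.frame_N.sectionalCurvature_eq he.isOpen_V hdata.bracket_N hdata.smooth_F₁
      hdata.smooth_F₂ (he.mapsTo hx)
  -- The equivalence holds point by point: a vector vanishes exactly when both its components in the
  -- orthonormal frame do.
  refine forall₂_congr fun x hx => ?_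
  rw [hdata.tritension_eq he hs hk₂ hAs hBs hAB hx,
    he.frame_N.pair_eq_zero_iff (he.mapsTo hx), hKx x hx]
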